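/- Let $d\ge 0$, $m\ge 1$, and let $P\subseteq(\mathbb R^d)^*$ be a full-dimensional lattice polytope with inner normal fan $\Sigma_P$ in $\mathbb R^d$. Let $\delta\colon\mathbb R^d\to(\mathbb R^d)^m$ be the diagonal, $q\colon(\mathbb R^d)^m\to(\mathbb R^d)^m/\mathbb R^d$ the quotient by it, and let $\delta^*(f_1,\dots,f_m)=f_1+\dots+f_m$ and $q^*$ be the dual maps; all spaces carry their standard lattices. Let $H$ be the dense torus of the toric variety $X_P$. The quotient fan $\mathcal Q(P,m)$ is the common refinement of the cones $q(\tau)$, $\tau\in\Sigma_P^m$, i.e. the set of all cones $\bigcap_{\tau\in\Sigma_P^m,\ x\in q(\tau)}q(\tau)$ with $x\in(\mathbb R^d)^m/\mathbb R^d$, and $\mathcal R(P,m)=\{q^{-1}(\xi)\cap\tau \mid \xi\in\mathcal Q(P,m),\ \tau\in\Sigma_P^m\}$. Let $\Phi=\{\frac1{\mathrm{vol}(mP)}\int_{mP}\gamma(x)\,dx\}$, where $\gamma$ runs over the integrable sections of $\delta^*\colon P^m\to mP$, be the Billera--Sturmfels fiber polytope. A lattice polytope $Q\subseteq((\mathbb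 R^d)^m/\mathbb R^d)^*$ is called a fiber polytope of scale $c>0$ if $q^*(Q)$ is a translate of $c\,\Phi$; the polytope of the polarization of $X_{\mathcal Q(P,m)}$ induced by the Chow quotient $X_P^m/\!/H$ is the one of scale $c=(d+1)!\,\mathrm{vol}(mP)$, and is determined up to translation. For $Q=Q(P,m)$ a fiber polytope of some scale, let $R(P,m)\subseteq((\mathbb R^d)^m)^*$ be the polytope of the polarization pulled back from $X_P^m\times X_{\mathcal Q(P,m)}$, polarized by $P^m\times Q$, along the toric morphism given by $\iota=\mathrm{id}\times q$; that is, $$R(P,m)=\{u \mid \langle u,v\rangle\ge \psi(\iota(v))\ \text{for all } v\in(\mathbb R^d)^m\},$$ where $\psi(w)=\min_{z\in P^m\times Q}\langle z,w\rangle$ is the support function of $P^m\times Q$. Two polytopes are normally equivalent if they have the same dimension, there is an inclusion-preserving bijection between their faces such that the affine hulls of corresponding faces are translates of each other, and their inner normal fans coincide. Given a linear map $\pi$ that maps a lattice $M$ onto a lattice $\Lambda$, a polytope $R\subseteq M_{\mathbb R}$ is a generalized $\pi$-twisted Cayley sum of $R_1,\dots,R_k$ over $F$ if the $R_i\subseteq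 M_{\mathbb R}$ are pairwise normally equivalent lattice polytopes, each $\pi_{\mathbb R}(R_i)$ is a single lattice point $v_i\in\Lambda$, $R=\mathrm{Conv}(R_1,\dots,R_k)$ and $F=\mathrm{Conv}(v_1,\dots,v_k)$. Theorem. A fiber polytope $Q$ of scale $(d+1)!\,\mathrm{vol}(mP)$ exists. For every fiber polytope $Q=Q(P,m)$ of any scale $c>0$, the following hold. 1. $\mathcal Q(P,m)$ is the normal fan of $Q(P,m)$, and $R(P,m)$ is a lattice polytope whose normal fan is $\mathcal R(P,m)$. 2. $R(P,m)$ is the Minkowski sum $P^m+q^*(Q(P,m))$. 3. $\delta^*(R(P,m))=mP$, and $R(P,m)$ is a generalized $\delta^*$-twisted Cayley sum over $mP$ of finitely many lattice polytopes $R_1,\dots,R_k$, each normally equivalent to $q^*(Q(P,m))$. 4. For every $v\in mP$, the fiber of $\delta^*\colon R(P,m)\to mP$ over $v$ equals $\{x\in P^m\mid\delta^*(x)=v\}+q^*(Q(P,m))$ and is normally equivalent to $q^*(Q(P,m))$. -/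

import Mathlib

open scoped Pointwise

namespace TwistedCayley

/-! ### Polytopes, faces, normal fans

`M` is the space containing polytopes, `N` the space containing fans, and
`B : M →ₗ[ℝ] N →ₗ[ℝ] ℝ` the pairing between them. -/

/-- A lattice polytope with respect to the lattice `L`: the convex hull of a nonempty finite
set of lattice points. -/
def IsLatticePolytope {M : Type*} [AddCommGroup M] [Module ℝ M] (L : AddSubgroup M)
    (K : Set M) : Prop :=
  ∃ S : Finset M, S.Nonempty ∧ (S : Set M) ⊆ (L : Set M) ∧ K = convexHull ℝ (S : Set M)

/-- The (inner) normal cone of `K` at the point `u`: all `v` such that `⟨·, v⟩` attains its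
minimum over `K` at `u`. -/
def normalCone {M N : Type*} [AddCommGroup M] [Module ℝ M] [AddCommGroup N] [Module ℝ N]
    (B : M →ₗ[ℝ] N →ₗ[ℝ] ℝ) (K : Set M) (u : M) : Set N :=
  {v | ∀ u' ∈ K, B u v ≤ B u' v}

/-- The (inner) normal fan of `K`, as the set of its cones. The cone belonging to a face `F` is
the normal cone at any point of the relative interior of `F`. -/
def normalFan {M N : Type*} [AddCommGroup M] [Module ℝ M] [AddCommGroup N] [Module ℝ N]
    (B : M →ₗ[ℝ] N →ₗ[ℝ] ℝ) (K : Set M) : Set (Set N) :=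
  normalCone B K '' K

/-- Strict combinatorial isomorphism of polytopes: they have the same dimension, and there is an
inclusion-preserving bijection of faces such that the affine hulls of corresponding faces are
translates of each other. -/
def StrictlyCombinatoriallyIsomorphic {M : Type*} [NormedAddCommGroup M] [NormedSpace ℝ M]
    (K K' : Set M) : Prop :=
  Module.finrank ℝ (affineSpan ℝ K).direction = Module.finrank ℝ (affineSpan ℝ K').direction ∧
  ∃ φ : {F : Set M // IsExposed ℝ K F} ≃o {F : Set M // IsExposed ℝ K' F},
    ∀ F, ∃ t : M, (affineSpan ℝ (φ F).1 : Set M) = (fun x => t + x) '' (affineSpan ℝ F.1 : Set M)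

/-- Normal equivalence of polytopes: strictly combinatorially isomorphic, with equal inner
normal fans. -/
def NormallyEquivalent {M N : Type*} [NormedAddCommGroup M] [NormedSpace ℝ M]
    [AddCommGroup N] [Module ℝ N] (B : M →ₗ[ℝ] N →ₗ[ℝ] ℝ) (K K' : Set M) : Prop :=
  StrictlyCombinatoriallyIsomorphic K K' ∧ normalFan B K = normalFan B K'

/-- `R` is the generalized `π`-twisted Cayley sum, fibred over `F`, of the polytopes
`R₁, …, Rₖ`: here `π` maps the lattice `L` onto the lattice `Λ`, the `Rᵢ` are pairwise normally
equivalent lattice polytopes, each `π(Rᵢ)` is a lattice point `vᵢ`, and `R` and `F` are the convex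
hulls of the `Rᵢ` and of the `vᵢ`. -/
def IsGeneralizedTwistedCayleySum {M N E : Type*} [NormedAddCommGroup M] [NormedSpace ℝ M]
    [AddCommGroup N] [Module ℝ N] [AddCommGroup E] [Module ℝ E]
    (B : M →ₗ[ℝ] N →ₗ[ℝ] ℝ) (L : AddSubgroup M) (Λ : AddSubgroup E) (π : M →ₗ[ℝ] E)
    {k : ℕ} (Rs : Fin k → Set M) (R : Set M) (F : Set E) : Prop :=
  L.map π.toAddMonoidHom = Λ ∧
  (∀ i, IsLatticePolytope L (Rs i)) ∧
  (∀ i j, NormallyEquivalent B (Rs i) (Rs j)) ∧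
  R = convexHull ℝ (⋃ i, Rs i) ∧
  ∃ v : Fin k → E, (∀ i, v i ∈ Λ) ∧ (∀ i, π '' Rs i = {v i}) ∧ F = convexHull ℝ (Set.range v)

/-- The support function of a polytope, `v ↦ min_{u ∈ K} ⟨u, v⟩`: the piecewise linear function
on the normal fan of `K` that describes the polarization given by `K`. -/
noncomputable def supportFunction {M N : Type*} [AddCommGroup M] [Module ℝ M] [AddCommGroup N]
    [Module ℝ N] (B : M →ₗ[ℝ] N →ₗ[ℝ] ℝ) (K : Set M) (v : N) : ℝ :=
  sInf ((fun u => B u v) '' K)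

/-- The polytope `{u | ⟨u, v⟩ ≥ ψ(v) for all v}` of the line bundle with support function `ψ`. -/
def polytopeOfSupportFunction {M N : Type*} [AddCommGroup M] [Module ℝ M] [AddCommGroup N]
    [Module ℝ N] (B : M →ₗ[ℝ] N →ₗ[ℝ] ℝ) (ψ : N → ℝ) : Set M :=
  {u | ∀ v, ψ v ≤ B u v}

/-- The common refinement of a family of cones: each point `x` contributes the intersection of all
members of the family that contain `x`. -/
def commonRefinement {N : Type*} (C : Set (Set N)) : Set (Set N) :=
  Set.range fun x : N => ⋂₀ {σ | σ ∈ C ∧ x ∈ σ}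

/-! ### The lattices, the diagonal and its quotient -/

/-- `ℤ^d ⊆ ℝ^d`. -/
def intLattice (d : ℕ) : AddSubgroup (Fin d → ℝ) :=
  ((Int.castAddHom ℝ).compLeft (Fin d)).range

/-- `(ℤ^d)^m ⊆ (ℝ^d)^m`. -/
def intLatticePow (d m : ℕ) : AddSubgroup (Fin m → Fin d → ℝ) :=
  (((Int.castAddHom ℝ).compLeft (Fin d)).compLeft (Fin m)).range

/-- The pairing of `(ℝ^d)^*` (in dual coordinates) with `ℝ^d`. -/
noncomputable def pairing (d : ℕ) : (Fin d → ℝ) →ₗ[ℝ] (Fin d → ℝ) →ₗ[ℝ] ℝ :=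
  LinearMap.mk₂ ℝ (fun u v => ∑ j, u j * v j)
    (fun u u' v => by simp [add_mul, Finset.sum_add_distrib])
    (fun c u v => by simp [Finset.mul_sum, mul_assoc])
    (fun u v v' => by simp [mul_add, Finset.sum_add_distrib])
    (fun c u v => by simp [Finset.mul_sum, mul_left_comm])

/-- The pairing of `((ℝ^d)^m)^*` (in dual coordinates) with `(ℝ^d)^m`. -/
noncomputable def pairingPow (d m : ℕ) :
    (Fin m → Fin d → ℝ) →ₗ[ℝ] (Fin m → Fin d → ℝ) →ₗ[ℝ] ℝ :=
  LinearMap.mk₂ ℝ (fun u v => ∑ i, pairing d (u i) (v i))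
    (fun u u' v => by simp [Finset.sum_add_distrib])
    (fun c u v => by simp [Finset.mul_sum])
    (fun u v v' => by simp [Finset.sum_add_distrib])
    (fun c u v => by simp [Finset.mul_sum])

/-- The diagonal embedding `δ : ℝ^d → (ℝ^d)^m`. -/
def diag (d m : ℕ) : (Fin d → ℝ) →ₗ[ℝ] (Fin m → Fin d → ℝ) :=
  LinearMap.pi fun _ => LinearMap.id

/-- The dual `δ^* : ((ℝ^d)^m)^* → (ℝ^d)^*` of the diagonal, `(f₁, …, fₘ) ↦ f₁ + ⋯ + fₘ`. -/
def diagStar (d m : ℕ) : (Fin m → Fin d → ℝ) →ₗ[ℝ] (Fin d → ℝ) :=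
  ∑ i, LinearMap.proj i

/-- The quotient `(ℝ^d)^m / ℝ^d` by the diagonal. -/
abbrev DiagQuot (d m : ℕ) : Type :=
  (Fin m → Fin d → ℝ) ⧸ LinearMap.range (diag d m)

/-- The quotient map `q : (ℝ^d)^m → (ℝ^d)^m / ℝ^d`. -/
def quot (d m : ℕ) : (Fin m → Fin d → ℝ) →ₗ[ℝ] DiagQuot d m :=
  (LinearMap.range (diag d m)).mkQ

/-- The dual `q^* : ((ℝ^d)^m / ℝ^d)^* → ((ℝ^d)^m)^*` of the quotient map, in coordinates. -/
def quotStar (d m : ℕ) : Module.Dual ℝ (DiagQuot d m) →ₗ[ℝ] (Fin m → Fin d → ℝ) where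
  toFun y := fun i j => y (quot d m (Pi.single i (Pi.single j 1)))
  map_add' _ _ := rfl
  map_smul' _ _ := rfl

theorem pairing_diagStar (d m : ℕ) (u : Fin m → Fin d → ℝ) (v : Fin d → ℝ) :
    pairing d (diagStar d m u) v = pairingPow d m u (diag d m v) := by
  simp [pairing, pairingPow, diagStar, diag, Finset.sum_apply]

theorem pairingPow_quotStar (d m : ℕ) (y : Module.Dual ℝ (DiagQuot d m))
    (v : Fin m → Fin d → ℝ) : pairingPow d m (quotStar d m y) v = y (quot d m v) := by
  have h : v = ∑ i, ∑ j, v i j • (Pi.single i (Pi.single j 1) : Fin m → Fin d → ℝ) := by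
    ext i j
    simp [Finset.sum_apply, Pi.single_apply, Finset.sum_ite_eq, ite_apply]
  conv_rhs => rw [h]
  simp [pairing, pairingPow, quotStar, map_sum, mul_comm]

/-- The character lattice of `H^m / H`, i.e. the lattice dual to `(ℤ^d)^m / ℤ^d`: the functionals
that are integral on the standard basis of `(ℤ^d)^m`. -/
def quotDualLattice (d m : ℕ) : AddSubgroup (Module.Dual ℝ (DiagQuot d m)) :=
  (intLatticePow d m).comap (quotStar d m).toAddMonoidHom

/-! ### The fans and polytopes attached to `P` and `m` -/

/-- `P^m ⊆ (ℝ^d)^m`. -/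
def polyPow {d : ℕ} (P : Set (Fin d → ℝ)) (m : ℕ) : Set (Fin m → Fin d → ℝ) :=
  Set.univ.pi fun _ => P

/-- The product fan `Σ_P^m`, whose cones are the products of `m` cones of the normal fan of `P`. -/
def fanPow {d : ℕ} (P : Set (Fin d → ℝ)) (m : ℕ) : Set (Set (Fin m → Fin d → ℝ)) :=
  {τ | ∃ σ : Fin m → Set (Fin d → ℝ), (∀ i, σ i ∈ normalFan (pairing d) P) ∧
    τ = Set.univ.pi σ}

/-- The quotient fan `𝒬(P,m)`: the common refinement of the images under `q` of the cones
of `Σ_P^m`. -/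
def quotientFan {d : ℕ} (P : Set (Fin d → ℝ)) (m : ℕ) : Set (Set (DiagQuot d m)) :=
  commonRefinement ((fun τ => quot d m '' τ) '' fanPow P m)

/-- The fan `ℛ(P,m) = {q⁻¹(ξ) ∩ τ | ξ ∈ 𝒬(P,m), τ ∈ Σ_P^m}`. -/
def familyFan {d : ℕ} (P : Set (Fin d → ℝ)) (m : ℕ) : Set (Set (Fin m → Fin d → ℝ)) :=
  {ρ | ∃ ξ ∈ quotientFan P m, ∃ τ ∈ fanPow P m, ρ = quot d m ⁻¹' ξ ∩ τ}

/-- The Billera–Sturmfels fiber polytope of the fibration `δ^* : P^m → mP`: the set of averages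
over `mP` of all its integrable sections. -/
noncomputable def fiberPolytope {d : ℕ} (P : Set (Fin d → ℝ)) (m : ℕ) :
    Set (Fin m → Fin d → ℝ) :=
  {w | ∃ γ : (Fin d → ℝ) → (Fin m → Fin d → ℝ),
    MeasureTheory.IntegrableOn γ ((m : ℝ) • P) ∧
    (∀ x ∈ (m : ℝ) • P, γ x ∈ polyPow P m ∧ diagStar d m (γ x) = x) ∧
    w = ⨍ x in (m : ℝ) • P, γ x}

/-- `Q` is a lattice polytope in `((ℝ^d)^m / ℝ^d)^*` that is, after applying `q^*` and up to
translation, `c` times the fiber polytope of `δ^* : P^m → mP`. -/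
def IsFiberPolytope {d : ℕ} (P : Set (Fin d → ℝ)) (m : ℕ) (c : ℝ)
    (Q : Set (Module.Dual ℝ (DiagQuot d m))) : Prop :=
  IsLatticePolytope (quotDualLattice d m) Q ∧
  ∃ t : Fin m → Fin d → ℝ, quotStar d m '' Q = (fun w => t + c • w) '' fiberPolytope P m

/-- The factor by which the fiber polytope (an average) has to be multiplied to give the weight
polytope of the Chow form of the closure of a general `H`-orbit, i.e. the polytope of the
polarization of the Chow quotient `X_P^m // H`: it is `(d+1)! · vol(mP)`. -/
noncomputable def chowScale {d : ℕ} (P : Set (Fin d → ℝ)) (m : ℕ) : ℝ :=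
  (d + 1).factorial * MeasureTheory.volume.real ((m : ℝ) • P)

/-- The pairing of `((ℝ^d)^m)^* × ((ℝ^d)^m / ℝ^d)^*` with `(ℝ^d)^m × (ℝ^d)^m / ℝ^d`. -/
noncomputable def pairingProd (d m : ℕ) :
    ((Fin m → Fin d → ℝ) × Module.Dual ℝ (DiagQuot d m)) →ₗ[ℝ]
      ((Fin m → Fin d → ℝ) × DiagQuot d m) →ₗ[ℝ] ℝ :=
  LinearMap.mk₂ ℝ (fun u v => pairingPow d m u.1 v.1 + u.2 v.2)
    (fun u u' v => by simp; ring)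
    (fun c u v => by simp [mul_add])
    (fun u v v' => by simp; ring)
    (fun c u v => by simp [mul_add])

/-- The embedding `ι = id × q : (ℝ^d)^m → (ℝ^d)^m × (ℝ^d)^m / ℝ^d`. -/
def graphEmb (d m : ℕ) : (Fin m → Fin d → ℝ) →ₗ[ℝ] (Fin m → Fin d → ℝ) × DiagQuot d m :=
  LinearMap.id.prod (quot d m)

/-- The polytope `R(P,m)` of the polarization on `X_{ℛ(P,m)}` induced from `X_P^m × X_{𝒬(P,m)}`
(polarized by `P^m × Q`) through the toric morphism given by `ι`. The pulled back polarization has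
as support function the composition with `ι` of the support function of `P^m × Q`. -/
noncomputable def familyPolytope {d : ℕ} (P : Set (Fin d → ℝ)) (m : ℕ)
    (Q : Set (Module.Dual ℝ (DiagQuot d m))) : Set (Fin m → Fin d → ℝ) :=
  polytopeOfSupportFunction (pairingPow d m)
    fun v => supportFunction (pairingProd d m) (polyPow P m ×ˢ Q) (graphEmb d m v)

/-- The fiber of `δ^*` over `v` in a subset of `(ℝ^d)^m`. -/
def fiberOver {d m : ℕ} (K : Set (Fin m → Fin d → ℝ)) (v : Fin d → ℝ) :
    Set (Fin m → Fin d → ℝ) :=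
  {u | u ∈ K ∧ diagStar d m u = v}

end TwistedCayley

open TwistedCayley

/-! Everything is governed by one preorder on the vectors `w` of (ℝ^d)^m: `w` precedes `w'` if every
point of P^m that minimizes `w` on its δ*-fiber also minimizes `w'` there, that is, if `fiberMin` of
`w` lies in `fiberMin` of `w'`. The normal fan of a polytope is its own common refinement
(`commonRefinement_normalFan`), so it amounts to the inclusion relation between minimal faces.
Polytopes with the same inclusions have the same normal fan, and then they are normally equivalent
(`normallyEquivalent_of_normalFan_eq`).

Both the quotient fan and the fiber polytope produce this preorder. By linear programming duality
(`mem_fiberMin_iff`), `u` minimizes `w` on its fiber iff `w + δ(h)` is normal to P^m at `u` for some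
`h`, that is, iff q(w) lies in the image of the normal cone at `u`. On the other side, a section has
minimal integral against `w` iff almost all its values minimize `w` fiberwise, and comparing such
sections recovers the inclusions (`fiberMin_subset_iff`). Hence 𝒬(P,m) is the normal fan of Q. A
single fiber of P^m only sees part of `fiberMin`, so its own inclusions are implied by those of
q*(Q); adding the fiber to q*(Q) leaves the normal fan unchanged, which is the normal equivalence of
the fibers of R.

The rest is formal. The support function of P^m × Q composed with ι is that of P^m + q*(Q), normal
cones of a Minkowski sum are intersections, and δ* ∘ q* = 0 confines each translate of q*(Q) to one
fiber; the Cayley summands are the translates by tuples of generators of P.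

For existence, a generic perturbation of the heights makes the optimal simplices a triangulation of
mP (`exists_generic_heights`, `Cell.measure_inter_eq_zero`). A minimal section integral is then a
sum of integrals of affine lifts, and a barycentric coordinate of a lattice simplex integrates to an
integer over (d+1)! (`Cell.exists_integral_lam`). Every functional is thus minimized at one of
finitely many lattice points, and Hahn–Banach identifies the set of integrals with their hull. -/

namespace TwistedCayley

/-! ### Minimal faces, normal cones and normal fans -/

section Faces

variable {M N : Type*} [AddCommGroup M] [Module ℝ M] [AddCommGroup N] [Module ℝ N]
  (B : M →ₗ[ℝ] N →ₗ[ℝ] ℝ)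

/-- The face of `K` on which the pairing with `w` is minimal. -/
def minFace (K : Set M) (w : N) : Set M := {u | u ∈ K ∧ w ∈ normalCone B K u}

theorem mem_normalCone_convexHull {S : Set M} {u : M} {w : N} :
    w ∈ normalCone B (convexHull ℝ S) u ↔ ∀ s ∈ S, B u w ≤ B s w := by
  refine ⟨fun h s hs => h s (subset_convexHull ℝ S hs), fun h u' hu' => ?_⟩
  have hc : Convex ℝ {x : M | B u w ≤ B x w} :=
    convex_halfSpace_ge (f := fun x => B x w)
      ⟨fun x y => by simp, fun c x => by simp⟩ (B u w)
  exact convexHull_min (fun s hs => h s hs) hc hu'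

theorem minFace_nonempty {S : Finset M} (hS : S.Nonempty) (w : N) :
    (minFace B (convexHull ℝ (S : Set M)) w).Nonempty := by
  obtain ⟨s, hs, hmin⟩ := S.exists_min_image (fun s => B s w) hS
  exact ⟨s, subset_convexHull ℝ _ hs, (mem_normalCone_convexHull B).2 hmin⟩

theorem mem_sInter_normalFan {K : Set M} {w w' : N} :
    w' ∈ ⋂₀ {σ | σ ∈ normalFan B K ∧ w ∈ σ} ↔
      ∀ u ∈ K, w ∈ normalCone B K u → w' ∈ normalCone B K u := by
  simp only [Set.mem_sInter, Set.mem_ofPred_eq, normalFan, Set.mem_image]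
  constructor
  · intro h u hu hw
    exact h _ ⟨⟨u, hu, rfl⟩, hw⟩
  · rintro h _ ⟨⟨u, hu, rfl⟩, hw⟩
    exact h u hu hw

/-- The bridge between fans and faces: the refined cone of `w` consists of the vectors whose minimal
face contains that of `w`. -/
theorem minFace_subset_iff {K : Set M} {w w' : N} :
    minFace B K w ⊆ minFace B K w' ↔ w' ∈ ⋂₀ {σ | σ ∈ normalFan B K ∧ w ∈ σ} := by
  rw [mem_sInter_normalFan]
  exact ⟨fun h u hu hw => (h ⟨hu, hw⟩).2, fun h u hu => ⟨hu.1, h u hu.1 hu.2⟩⟩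

/-- The normal fan of a polytope is its own common refinement. -/
theorem commonRefinement_normalFan {S : Finset M} (hS : S.Nonempty) :
    commonRefinement (normalFan B (convexHull ℝ (S : Set M))) =
      normalFan B (convexHull ℝ (S : Set M)) := by
  classical
  set K := convexHull ℝ (S : Set M) with hK
  apply Set.Subset.antisymm
  · rintro _ ⟨w, rfl⟩
    obtain ⟨s₀, hs₀, hmin⟩ := S.exists_min_image (fun s => B s w) hS
    -- The barycenter `u` of the generators minimal for `w` lies in the relative interior of the
    -- face of `w`, so its normal cone should be the refined cone of `w`.
    set T := S.filter fun s => B s w ≤ B s₀ w with hT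
    have hs₀T : s₀ ∈ T := by simp [hT, hs₀]
    have hTne : T.Nonempty := ⟨s₀, hs₀T⟩
    have hcard : (0 : ℝ) < T.card := by exact_mod_cast hTne.card_pos
    set u : M := (T.card : ℝ)⁻¹ • ∑ s ∈ T, s with hu
    have hpair : ∀ z : N, B u z = (T.card : ℝ)⁻¹ * ∑ s ∈ T, B s z := by
      intro z; simp [hu, map_sum]
    have huK : u ∈ K := by
      have : u = ∑ s ∈ T, (T.card : ℝ)⁻¹ • s := by rw [hu, Finset.smul_sum]
      rw [this]
      refine (convex_convexHull ℝ _).sum_mem (fun _ _ => by positivity) ?_ ?_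
      · simp [hcard.ne']
      · intro s hs
        exact subset_convexHull ℝ _ (Finset.filter_subset _ _ hs)
    have hmul : ∀ z, (T.card : ℝ) * B u z = ∑ s ∈ T, B s z := by
      intro z; rw [hpair]; field_simp
    refine ⟨u, huK, ?_⟩
    ext w'
    rw [mem_sInter_normalFan]
    constructor
    · intro hw' u₁ hu₁ hw
      -- every member of `T` is minimal for `w'`
      have hmem : ∀ t ∈ T, B t w' = B u w' := by
        by_contra! hcon
        obtain ⟨t, ht, hne⟩ := hcon
        have hlt : ∑ s ∈ T, B u w' < ∑ s ∈ T, B s w' :=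
          Finset.sum_lt_sum
            (fun s hs => hw' s (subset_convexHull ℝ _ (Finset.filter_subset _ _ hs)))
            ⟨t, ht, lt_of_le_of_ne
              (hw' t (subset_convexHull ℝ _ (Finset.filter_subset _ _ ht))) hne.symm⟩
        rw [← hmul, Finset.sum_const, nsmul_eq_mul] at hlt
        exact lt_irrefl _ hlt
      -- `u₁` is a convex combination of members of `T`
      obtain ⟨c, hc0, hc1, hcu⟩ := (Finset.mem_convexHull' (R := ℝ)).1 hu₁
      have hval : ∀ z, B u₁ z = ∑ s ∈ S, c s * B s z := by
        intro z; rw [← hcu]; simp [map_sum]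
      have hzero : ∀ s ∈ S, s ∉ T → c s = 0 := by
        intro s hs hsT
        by_contra hne
        have hlt : ∑ s ∈ S, c s * B s₀ w < ∑ s ∈ S, c s * B s w := by
          refine Finset.sum_lt_sum
            (fun t ht => mul_le_mul_of_nonneg_left (hmin t ht) (hc0 t ht)) ⟨s, hs, ?_⟩
          refine mul_lt_mul_of_pos_left ?_ (lt_of_le_of_ne (hc0 s hs) (Ne.symm hne))
          simpa [hT, hs] using hsT
        rw [← Finset.sum_mul, hc1, one_mul, ← hval] at hlt
        exact absurd (hw s₀ (subset_convexHull ℝ _ hs₀)) (not_le.2 hlt)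
      have heq : B u₁ w' = B u w' := by
        rw [hval]
        have : ∀ s ∈ S, c s * B s w' = c s * B u w' := by
          intro s hs
          by_cases hsT : s ∈ T
          · rw [hmem s hsT]
          · rw [hzero s hs hsT]; simp
        rw [Finset.sum_congr rfl this, ← Finset.sum_mul, hc1, one_mul]
      intro u' hu'
      rw [heq]
      exact hw' u' hu'
    · intro h
      refine h u huK ?_
      rw [hK, mem_normalCone_convexHull]
      intro s hs
      have h1 : ∑ s ∈ T, B s w ≤ ∑ t ∈ T, B s₀ w :=
        Finset.sum_le_sum fun t ht => (Finset.mem_filter.1 ht).2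
      rw [← hmul, Finset.sum_const, nsmul_eq_mul] at h1
      exact (le_of_mul_le_mul_left h1 hcard).trans (hmin s hs)
  · rintro _ ⟨u, hu, rfl⟩
    -- a point in the relative interior of the normal cone
    have hex : ∀ s : M, ∃ z ∈ normalCone B K u,
        (∃ z' ∈ normalCone B K u, B u z' < B s z') → B u z < B s z := by
      intro s
      by_cases h : ∃ z' ∈ normalCone B K u, B u z' < B s z'
      · obtain ⟨z', hz', hlt⟩ := h
        exact ⟨z', hz', fun _ => hlt⟩
      · exact ⟨0, fun u' _ => by simp, fun h' => absurd h' h⟩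
    choose z hz hzs using hex
    have hzS : ∀ s ∈ S, ∀ t : M, B u (z t) ≤ B s (z t) :=
      fun s hs t => hz t s (subset_convexHull ℝ _ hs)
    -- Summing makes the strict inequalities simultaneous: the sum separates from `u` every
    -- generator that some normal vector at `u` separates from it.
    refine ⟨∑ s ∈ S, z s, ?_⟩
    have hsum : ∑ s ∈ S, z s ∈ normalCone B K u := by
      rw [hK, mem_normalCone_convexHull]
      intro s hs
      simp only [map_sum]
      exact Finset.sum_le_sum fun t _ => hzS s hs t
    ext w'
    rw [mem_sInter_normalFan]
    constructor
    · intro h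
      exact h u hu hsum
    · intro hw' u₁ hu₁ hw
      obtain ⟨c, hc0, hc1, hcu⟩ := (Finset.mem_convexHull' (R := ℝ)).1 hu₁
      have hval : ∀ z, B u₁ z = ∑ s ∈ S, c s * B s z := by
        intro z; rw [← hcu]; simp [map_sum]
      have heq : B u₁ w' = B u w' := by
        rw [hval]
        have : ∀ s ∈ S, c s * B s w' = c s * B u w' := by
          intro s hs
          by_cases hcs : c s = 0
          · simp [hcs]
          congr 1
          refine le_antisymm ?_ (hw' s (subset_convexHull ℝ _ hs))
          by_contra! hlt
          have hstrict := hzs s ⟨w', hw', hlt⟩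
          have h1 : B u (∑ s ∈ S, z s) < B s (∑ s ∈ S, z s) := by
            simp only [map_sum]
            exact Finset.sum_lt_sum (fun t _ => hzS s hs t) ⟨s, hs, hstrict⟩
          have h2 : ∑ t ∈ S, c t * B u (∑ s ∈ S, z s) < ∑ t ∈ S, c t * B t (∑ s ∈ S, z s) :=
            Finset.sum_lt_sum (fun t ht => mul_le_mul_of_nonneg_left
                (hsum t (subset_convexHull ℝ _ ht)) (hc0 t ht))
              ⟨s, hs, mul_lt_mul_of_pos_left h1
                (lt_of_le_of_ne (hc0 s hs) (Ne.symm hcs))⟩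
          rw [← Finset.sum_mul, hc1, one_mul, ← hval] at h2
          exact absurd (hw u hu) (not_le.2 h2)
        rw [Finset.sum_congr rfl this, ← Finset.sum_mul, hc1, one_mul]
      intro u' hu'
      rw [heq]
      exact hw' _ hu'

/-- The normal cone of a Minkowski sum. -/
theorem normalCone_add {K L : Set M} {a b : M} (ha : a ∈ K) (hb : b ∈ L) :
    normalCone B (K + L) (a + b) = normalCone B K a ∩ normalCone B L b := by
  ext w
  constructor
  · intro h
    refine ⟨fun a' ha' => ?_, fun b' hb' => ?_⟩
    · simpa using h (a' + b) (Set.add_mem_add ha' hb)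
    · simpa using h (a + b') (Set.add_mem_add ha hb')
  · rintro ⟨h1, h2⟩ _ ⟨a', ha', b', hb', rfl⟩
    simpa using add_le_add (h1 a' ha') (h2 b' hb')

theorem normalFan_translate (t : M) (K : Set M) :
    normalFan B ((fun x => t + x) '' K) = normalFan B K := by
  have h : ∀ u, normalCone B ((fun x => t + x) '' K) (t + u) = normalCone B K u := by
    intro u
    ext w
    constructor
    · intro h u' hu'
      simpa using h (t + u') ⟨u', hu', rfl⟩
    · rintro h _ ⟨u', hu', rfl⟩
      simpa using h u' hu'
  simp only [normalFan, Set.image_image, h]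

theorem minFace_zero (K : Set M) : minFace B K 0 = K := by
  ext u
  simp [minFace, normalCone]

/-- Finiteness gives a uniform step length: a perturbation that vanishes wherever the slack does can
be scaled below the slack everywhere. -/
theorem exists_pos_forall_mul_abs_le {ι : Type*} (S : Finset ι) (α β : ι → ℝ)
    (h0 : ∀ s ∈ S, 0 ≤ α s) (h : ∀ s ∈ S, α s = 0 → β s = 0) :
    ∃ ε > 0, ∀ s ∈ S, ε * |β s| ≤ α s := by
  induction S using Finset.cons_induction with
  | empty => exact ⟨1, one_pos, by simp⟩
  | cons a S ha ih =>
    obtain ⟨ε, hε, hS⟩ := ih (fun s hs => h0 s (by simp [hs])) (fun s hs => h s (by simp [hs]))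
    have h0a := h0 a (by simp)
    by_cases hb : β a = 0
    · refine ⟨ε, hε, fun s hs => ?_⟩
      rcases Finset.mem_cons.1 hs with rfl | hs
      · simpa [hb] using h0a
      · exact hS s hs
    · have hpos : 0 < α a := lt_of_le_of_ne h0a fun h' => hb (h a (by simp) h'.symm)
      have hbpos : 0 < |β a| := abs_pos.2 hb
      refine ⟨min ε (α a / |β a|), lt_min hε (by positivity), fun s hs => ?_⟩
      rcases Finset.mem_cons.1 hs with rfl | hs
      · calc _ ≤ α s / |β s| * |β s| := by gcongr; exact min_le_right _ _
          _ = α s := by field_simp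
      · exact (mul_le_mul_of_nonneg_right (min_le_left _ _) (abs_nonneg _)).trans (hS s hs)

/-- A functional is constant on a face of a polytope iff a small perturbation by it in both
directions does not make the face smaller. -/
theorem constant_on_minFace_iff {S : Finset M} (hS : S.Nonempty) (w z : N) :
    (∀ u ∈ minFace B (convexHull ℝ (S : Set M)) w, ∀ u' ∈ minFace B (convexHull ℝ (S : Set M)) w,
      B u z = B u' z) ↔
    ∃ ε : ℝ, 0 < ε ∧
      minFace B (convexHull ℝ (S : Set M)) w ⊆ minFace B (convexHull ℝ (S : Set M)) (w + ε • z) ∧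
      minFace B (convexHull ℝ (S : Set M)) w ⊆
        minFace B (convexHull ℝ (S : Set M)) (w - ε • z) := by
  set K := convexHull ℝ (S : Set M) with hK
  constructor
  · intro h
    obtain ⟨u₀, hu₀⟩ := minFace_nonempty B hS w
    -- The slack of a generator is its excess over the minimum of `w`. Zero slack means that the
    -- generator is in the face, where `z` is constant.
    obtain ⟨ε, hε, hS'⟩ := exists_pos_forall_mul_abs_le S (fun s => B s w - B u₀ w)
      (fun s => B s z - B u₀ z)
      (fun s hs => sub_nonneg.2 (hu₀.2 s (subset_convexHull ℝ _ hs)))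
      (fun s hs hs0 => by
        rw [h s ⟨subset_convexHull ℝ _ hs, fun u' hu' => ?_⟩ u₀ hu₀, sub_self]
        rw [sub_eq_zero.1 hs0]
        exact hu₀.2 u' hu')
    refine ⟨ε, hε, ?_, ?_⟩ <;>
    · intro u hu
      refine ⟨hu.1, ?_⟩
      rw [hK, mem_normalCone_convexHull]
      intro s hs
      have h1 : B u w = B u₀ w := le_antisymm (hu.2 _ hu₀.1) (hu₀.2 _ hu.1)
      have h2 := h u hu u₀ hu₀
      have h3 := hS' s hs
      have h4 : ε * (B s z - B u₀ z) ≤ B s w - B u₀ w :=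
        (mul_le_mul_of_nonneg_left (le_abs_self _) hε.le).trans h3
      have h5 : ε * (-(B s z - B u₀ z)) ≤ B s w - B u₀ w :=
        (mul_le_mul_of_nonneg_left (neg_le_abs _) hε.le).trans h3
      simp only [map_add, map_sub, map_smul, smul_eq_mul, h1, h2]
      linarith
  · rintro ⟨ε, hε, h1, -⟩ u hu u' hu'
    have a1 := (h1 hu).2 u' hu'.1
    have a2 := (h1 hu').2 u hu.1
    have b1 := hu.2 u' hu'.1
    have b2 := hu'.2 u hu.1
    simp only [map_add, map_smul, smul_eq_mul] at a1 a2
    have : ε * B u z = ε * B u' z := by linarith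
    exact mul_left_cancel₀ hε.ne' this

/-- The faces of `K'` that correspond to the faces of `K` by having the same normal vectors. -/
def transportFace (K K' F : Set M) : Set M :=
  {u' | u' ∈ K' ∧ F.Nonempty ∧ ∀ w, F ⊆ minFace B K w → u' ∈ minFace B K' w}

theorem transportFace_mono (K K' : Set M) {F G : Set M} (h : F ⊆ G) :
    transportFace B K K' F ⊆ transportFace B K K' G :=
  fun _ hu => ⟨hu.1, hu.2.1.mono h, fun w hw => hu.2.2 w (h.trans hw)⟩

/-- The clause `F.Nonempty` is there for this: every `w` satisfies the inclusion for `∅` vacuously,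
so without the clause a one-point `K'` would be returned whole. -/
theorem transportFace_empty (K K' : Set M) : transportFace B K K' ∅ = ∅ := by
  ext u; simp [transportFace]

theorem transportFace_minFace {K K' : Set M} (hne : ∀ w, (minFace B K w).Nonempty)
    (hle : ∀ w w', minFace B K w ⊆ minFace B K w' → minFace B K' w ⊆ minFace B K' w') (w : N) :
    transportFace B K K' (minFace B K w) = minFace B K' w := by
  ext u
  constructor
  · intro hu
    exact hu.2.2 w subset_rfl
  · intro hu
    exact ⟨hu.1, hne w, fun w' hw' => hle w w' hw' hu⟩

end Faces

/-! ### Equal normal fans imply normal equivalence -/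

section NormalEquivalence

variable {M N : Type*} [NormedAddCommGroup M] [NormedSpace ℝ M]
  [AddCommGroup N] [Module ℝ N] (B : M →ₗ[ℝ] N →ₗ[ℝ] ℝ)

/-- `IsExposed` maximizes a functional and admits the empty face, whereas `minFace` minimizes; hence
the sign change and the extra alternative. -/
theorem isExposed_iff_minFace [FiniteDimensional ℝ M]
    (hB : ∀ l : M →ₗ[ℝ] ℝ, ∃ w, ∀ u, B u w = l u) (K F : Set M) :
    IsExposed ℝ K F ↔ F = ∅ ∨ ∃ w, F = minFace B K w := by
  constructor
  · intro h
    rcases F.eq_empty_or_nonempty with h0 | hne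
    · exact Or.inl h0
    obtain ⟨l, hl⟩ := h hne
    obtain ⟨w, hw⟩ := hB (-l : M →L[ℝ] ℝ).toLinearMap
    refine Or.inr ⟨w, ?_⟩
    rw [hl]
    ext u
    simp [minFace, normalCone, hw]
  · rintro (rfl | ⟨w, rfl⟩)
    · exact fun h => absurd h (by simp)
    · intro _
      refine ⟨-(LinearMap.toContinuousLinearMap (B.flip w)), ?_⟩
      ext u
      simp [minFace, normalCone]

/-- The direction of a face is cut out by the functionals constant on it, and
`constant_on_minFace_iff` expresses that constancy by inclusions of minimal faces, which `hle`
carries over. -/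
theorem direction_minFace_le (hB : ∀ l : M →ₗ[ℝ] ℝ, ∃ w, ∀ u, B u w = l u) {S S' : Finset M}
    (hS : S.Nonempty) (hS' : S'.Nonempty)
    (hle : ∀ w w', minFace B (convexHull ℝ (S : Set M)) w ⊆ minFace B (convexHull ℝ (S : Set M)) w'
      → minFace B (convexHull ℝ (S' : Set M)) w ⊆ minFace B (convexHull ℝ (S' : Set M)) w')
    (w : N) :
    (affineSpan ℝ (minFace B (convexHull ℝ (S' : Set M)) w)).direction ≤
      (affineSpan ℝ (minFace B (convexHull ℝ (S : Set M)) w)).direction := by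
  intro x hx
  by_contra hx'
  obtain ⟨l, hlx, hl⟩ := Submodule.exists_le_ker_of_notMem hx'
  obtain ⟨z, hz⟩ := hB l
  have h1 : ∃ ε : ℝ, 0 < ε ∧ _ ∧ _ := (constant_on_minFace_iff B hS w z).1 (by
    intro u hu u' hu'
    rw [hz, hz, ← sub_eq_zero, ← map_sub]
    exact hl (AffineSubspace.vsub_mem_direction (subset_affineSpan ℝ _ hu)
      (subset_affineSpan ℝ _ hu')))
  obtain ⟨ε, hε, ha, hb⟩ := h1
  have h2 := (constant_on_minFace_iff B hS' w z).2 ⟨ε, hε, hle _ _ ha, hle _ _ hb⟩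
  refine hlx ?_
  have : (affineSpan ℝ (minFace B (convexHull ℝ (S' : Set M)) w)).direction ≤ LinearMap.ker l := by
    rw [direction_affineSpan, vectorSpan_def, Submodule.span_le]
    rintro _ ⟨u, hu, u', hu', rfl⟩
    change l (u - u') = 0
    rw [map_sub, ← hz, ← hz,
      h2 u hu u' hu', sub_self]
  exact this hx

/-- Polytopes with the same normal fan are normally equivalent. -/
theorem normallyEquivalent_of_normalFan_eq [FiniteDimensional ℝ M]
    (hB : ∀ l : M →ₗ[ℝ] ℝ, ∃ w, ∀ u, B u w = l u)
    {S S' : Finset M} (hS : S.Nonempty) (hS' : S'.Nonempty)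
    (hfan : normalFan B (convexHull ℝ (S : Set M)) = normalFan B (convexHull ℝ (S' : Set M))) :
    NormallyEquivalent B (convexHull ℝ (S : Set M)) (convexHull ℝ (S' : Set M)) := by
  set K := convexHull ℝ (S : Set M) with hK
  set K' := convexHull ℝ (S' : Set M) with hK'
  have hiff : ∀ w w', minFace B K w ⊆ minFace B K w' ↔ minFace B K' w ⊆ minFace B K' w' := by
    intro w w'
    rw [minFace_subset_iff, minFace_subset_iff, hfan]
  have hne : ∀ w, (minFace B K w).Nonempty := minFace_nonempty B hS
  have hne' : ∀ w, (minFace B K' w).Nonempty := minFace_nonempty B hS'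
  have ht := transportFace_minFace B hne fun w w' => (hiff w w').1
  have ht' := transportFace_minFace B hne' fun w w' => (hiff w w').2
  have hdir : ∀ w, (affineSpan ℝ (minFace B K w)).direction =
      (affineSpan ℝ (minFace B K' w)).direction := fun w =>
    le_antisymm (direction_minFace_le B hB hS' hS (fun w w' => (hiff w w').2) w)
      (direction_minFace_le B hB hS hS' (fun w w' => (hiff w w').1) w)
  refine ⟨⟨?_, ?_⟩, hfan⟩
  -- The minimal face of the zero vector is the whole polytope, so this case compares the
  -- dimensions.
  · have := hdir 0
    rw [minFace_zero, minFace_zero] at this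
    rw [this]
  · have hexp : ∀ {F}, IsExposed ℝ K F → IsExposed ℝ K' (transportFace B K K' F) := by
      intro F hF
      rw [isExposed_iff_minFace B hB] at hF ⊢
      rcases hF with rfl | ⟨w, rfl⟩
      · exact Or.inl (transportFace_empty B K K')
      · exact Or.inr ⟨w, ht w⟩
    have hexp' : ∀ {F}, IsExposed ℝ K' F → IsExposed ℝ K (transportFace B K' K F) := by
      intro F hF
      rw [isExposed_iff_minFace B hB] at hF ⊢
      rcases hF with rfl | ⟨w, rfl⟩
      · exact Or.inl (transportFace_empty B K' K)
      · exact Or.inr ⟨w, ht' w⟩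
    let e : {F : Set M // IsExposed ℝ K F} ≃ {F : Set M // IsExposed ℝ K' F} :=
      { toFun := fun F => ⟨transportFace B K K' F.1, hexp F.2⟩
        invFun := fun F => ⟨transportFace B K' K F.1, hexp' F.2⟩
        left_inv := by
          rintro ⟨F, hF⟩
          apply Subtype.ext
          rcases (isExposed_iff_minFace B hB K F).1 hF with rfl | ⟨w, rfl⟩
          · simp only [transportFace_empty]
          · change transportFace B K' K (transportFace B K K' (minFace B K w)) = minFace B K w
            rw [ht, ht']
        right_inv := by
          rintro ⟨F, hF⟩
          apply Subtype.ext
          rcases (isExposed_iff_minFace B hB K' F).1 hF with rfl | ⟨w, rfl⟩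
          · simp only [transportFace_empty]
          · change transportFace B K K' (transportFace B K' K (minFace B K' w)) = minFace B K' w
            rw [ht', ht] }
    refine ⟨e.toOrderIso (fun _ _ h => transportFace_mono B K K' h)
      (fun _ _ h => transportFace_mono B K' K h), ?_⟩
    rintro ⟨F, hF⟩
    rcases (isExposed_iff_minFace B hB K F).1 hF with rfl | ⟨w, rfl⟩
    · refine ⟨0, ?_⟩
      change (affineSpan ℝ (transportFace B K K' ∅) : Set M) = _
      simp [transportFace_empty]
    · change ∃ t, (affineSpan ℝ (transportFace B K K' (minFace B K w)) : Set M) = _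
      rw [ht w]
      obtain ⟨x, hx⟩ := hne w
      obtain ⟨x', hx'⟩ := hne' w
      have hx := subset_affineSpan ℝ _ hx
      have hx' := subset_affineSpan ℝ _ hx'
      refine ⟨x' - x, ?_⟩
      ext y
      simp only [Set.mem_image, SetLike.mem_coe]
      constructor
      · intro hy
        refine ⟨y - (x' - x), ?_, by abel⟩
        rw [← AffineSubspace.vsub_right_mem_direction_iff_mem hx, hdir]
        have := (AffineSubspace.vsub_right_mem_direction_iff_mem hx' y).2 hy
        have e1 : y - (x' - x) -ᵥ x = y -ᵥ x' := by simp only [vsub_eq_sub]; abel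
        rwa [e1]
      · rintro ⟨y, hy, rfl⟩
        rw [← AffineSubspace.vsub_right_mem_direction_iff_mem hx', ← hdir]
        have := (AffineSubspace.vsub_right_mem_direction_iff_mem hx y).2 hy
        have e1 : x' - x + y -ᵥ x' = y -ᵥ x := by simp only [vsub_eq_sub]; abel
        rwa [e1]

end NormalEquivalence

/-! ### Optimal simplices for a height function, by the simplex method -/

section Cells

open Module MeasureTheory

variable {A E : Type*} [NormedAddCommGroup E] [NormedSpace ℝ E]

/-- A full-dimensional simplex with vertices among the points `p a`. -/
structure Cell (p : A → E) where
  /-- the indices of the vertices -/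
  verts : Finset A
  ind : AffineIndependent ℝ fun i : verts => p i
  tot : affineSpan ℝ (Set.range fun i : verts => p i) = ⊤

variable {p : A → E}

theorem Cell.verts_injective : Function.Injective (Cell.verts : Cell p → Finset A) := by
  rintro ⟨s, _, _⟩ ⟨t, _, _⟩ h
  cases h
  rfl

instance [Finite A] : Finite (Cell p) := Finite.of_injective _ Cell.verts_injective

noncomputable instance [Finite A] : Fintype (Cell p) := Fintype.ofFinite _

noncomputable instance : DecidableEq (Cell p) := Classical.decEq _

/-- The affine basis formed by the vertices of a cell. -/
def Cell.basis (I : Cell p) : AffineBasis I.verts ℝ E := ⟨fun i => p i, I.ind, I.tot⟩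

open Classical in
/-- The barycentric coordinates with respect to a cell, extended by zero. -/
noncomputable def Cell.lam (I : Cell p) (a : A) : E →ᵃ[ℝ] ℝ :=
  if h : a ∈ I.verts then I.basis.coord ⟨a, h⟩ else 0

theorem Cell.lam_of_notMem (I : Cell p) {a : A} (h : a ∉ I.verts) : I.lam a = 0 := dif_neg h

theorem Cell.lam_of_mem (I : Cell p) {a : A} (h : a ∈ I.verts) :
    I.lam a = I.basis.coord ⟨a, h⟩ := dif_pos h

theorem Cell.sum_lam_smul [Fintype A] {V : Type*} [AddCommGroup V] [Module ℝ V] (I : Cell p) (x : E)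
    (f : A → V) : ∑ a, I.lam a x • f a = ∑ i : I.verts, I.basis.coord i x • f i := by
  classical
  rw [← Finset.sum_subset (Finset.subset_univ I.verts), ← Finset.sum_coe_sort I.verts]
  · exact Finset.sum_congr rfl fun i _ => by rw [I.lam_of_mem i.2]
  · intro a _ ha
    simp [I.lam_of_notMem ha]

theorem Cell.sum_lam [Fintype A] (I : Cell p) (x : E) : ∑ a, I.lam a x = 1 := by
  have := I.sum_lam_smul x (fun _ => (1 : ℝ))
  simp only [smul_eq_mul, mul_one] at this
  rw [this, I.basis.sum_coord_apply_eq_one]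

theorem Cell.sum_lam_smul_self [Fintype A] (I : Cell p) (x : E) : ∑ a, I.lam a x • p a = x :=
  (I.sum_lam_smul x p).trans (I.basis.linear_combination_coord_eq_self x)

open Classical in
theorem Cell.lam_apply_vertex (I : Cell p) {b : A} (hb : b ∈ I.verts) (a : A) :
    I.lam a (p b) = if a = b then 1 else 0 := by
  by_cases ha : a ∈ I.verts
  · rw [I.lam_of_mem ha]
    have : I.basis.coord ⟨a, ha⟩ (p b) = _ := I.basis.coord_apply ⟨a, ha⟩ ⟨b, hb⟩
    simpa [Subtype.ext_iff] using this
  · rw [I.lam_of_notMem ha, if_neg (by rintro rfl; exact ha hb)]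
    rfl

/-- Affine maps commute with affine combinations. -/
theorem affineMap_sum_smul {ι V W : Type*} [AddCommGroup V] [Module ℝ V] [AddCommGroup W]
    [Module ℝ W] [Fintype ι] (f : V →ᵃ[ℝ] W) {y : ι → ℝ} (hy : ∑ a, y a = 1) (q : ι → V) :
    f (∑ a, y a • q a) = ∑ a, y a • f (q a) := by
  have h : ∀ v, f v = f.linear v + f 0 := fun v => by
    simpa using f.map_vadd 0 v
  rw [h, map_sum]
  simp_rw [map_smul, h (q _), smul_add, Finset.sum_add_distrib, ← Finset.sum_smul, hy, one_smul]

theorem Cell.lam_unique [Fintype A] (I : Cell p) {y : A → ℝ} (hy : ∑ a, y a = 1)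
    (h0 : ∀ a ∉ I.verts, y a = 0) (a : A) : I.lam a (∑ b, y b • p b) = y a := by
  classical
  rw [affineMap_sum_smul _ hy, Finset.sum_eq_single a]
  · by_cases ha : a ∈ I.verts
    · simp [I.lam_apply_vertex ha]
    · simp [h0 a ha]
  · intro b _ hb
    by_cases hbI : b ∈ I.verts
    · simp [I.lam_apply_vertex hbI, hb.symm]
    · simp [h0 b hbI]
  · simp

/-- The simplex spanned by a cell. -/
def Cell.simplex (I : Cell p) : Set E := {x | ∀ a, 0 ≤ I.lam a x}

theorem Cell.lam_continuous [FiniteDimensional ℝ E] (I : Cell p) (a : A) :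
    Continuous (I.lam a) := (I.lam a).continuous_of_finiteDimensional

theorem Cell.isClosed_simplex [FiniteDimensional ℝ E] (I : Cell p) : IsClosed I.simplex := by
  simp only [Cell.simplex, Set.ofPred_forall]
  exact isClosed_iInter fun a => isClosed_le continuous_const (I.lam_continuous a)

/-- The affine interpolation of heights given on the vertices of a cell. -/
noncomputable def Cell.interp [Fintype A] (I : Cell p) (ω : A → ℝ) : E →ᵃ[ℝ] ℝ := ∑ a, ω a • I.lam a

theorem Cell.interp_apply [Fintype A] (I : Cell p) (ω : A → ℝ) (x : E) :
    I.interp ω x = ∑ a, ω a * I.lam a x := by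
  have : ∀ s : Finset A, (∑ a ∈ s, ω a • I.lam a) x = ∑ a ∈ s, ω a * I.lam a x := by
    intro s
    classical
    induction s using Finset.induction_on with
    | empty => simp
    | insert a s ha ih => rw [Finset.sum_insert ha, Finset.sum_insert ha, ← ih]; simp
  exact this _

theorem Cell.interp_vertex [Fintype A] (I : Cell p) (ω : A → ℝ) {b : A} (hb : b ∈ I.verts) :
    I.interp ω (p b) = ω b := by
  classical
  simp [Cell.interp_apply, I.lam_apply_vertex hb]

/-- A cell is optimal for the heights `ω` if its interpolation is a lower bound for `ω`. -/
def Cell.Optimal [Fintype A] (I : Cell p) (ω : A → ℝ) : Prop := ∀ a, I.interp ω (p a) ≤ ω a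

/-- The points that lie in a proper affine subspace spanned by some of the `p a`. -/
def degenerate (p : A → E) : Set E :=
  ⋃ s ∈ {s : Finset A | affineSpan ℝ (Set.range fun i : s => p i) ≠ ⊤},
    (affineSpan ℝ (Set.range fun i : s => p i) : Set E)

theorem sum_mem_affineSpan [Fintype A] {y : A → ℝ} (hy : ∑ a, y a = 1) {s : Finset A}
    (h0 : ∀ a ∉ s, y a = 0) :
    ∑ a, y a • p a ∈ affineSpan ℝ (Set.range fun i : s => p i) := by
  classical
  have h1 : ∑ i : s, y i = 1 := by
    rw [Finset.sum_coe_sort s y, ← hy]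
    exact Finset.sum_subset (Finset.subset_univ _) fun a _ ha => h0 a ha
  have h2 : ∑ a, y a • p a = ∑ i : s, y i • p i := by
    rw [Finset.sum_coe_sort s fun a => y a • p a]
    exact (Finset.sum_subset (Finset.subset_univ _) fun a _ ha => by simp [h0 a ha]).symm
  rw [h2]
  have := affineCombination_mem_affineSpan (k := ℝ) (s := Finset.univ)
    (w := fun i : s => y i) h1 (fun i : s => p i)
  rwa [Finset.affineCombination_eq_linear_combination _ _ _ h1] at this

/-- Nondegeneracy in the sense of linear programming: off `degenerate p`, no affine representation
can have a support that fails to span. -/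
theorem affineSpan_eq_top_of_notMem_degenerate [Fintype A] {y : A → ℝ} (hy : ∑ a, y a = 1) {s : Finset A}
    (h0 : ∀ a ∉ s, y a = 0) (hv : ∑ a, y a • p a ∉ degenerate p) :
    affineSpan ℝ (Set.range fun i : s => p i) = ⊤ := by
  by_contra hne
  exact hv (Set.mem_biUnion (show s ∈ {s : Finset A | _} from hne) (sum_mem_affineSpan hy h0))

/-- If a coordinate vanished, the other vertices would already span the space, although they lie on
the zero hyperplane of that coordinate. -/
theorem Cell.lam_pos [Fintype A] (I : Cell p) {v : E} (hv : v ∉ degenerate p) (hvI : v ∈ I.simplex)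
    {a : A} (ha : a ∈ I.verts) : 0 < I.lam a v := by
  classical
  refine lt_of_le_of_ne (hvI a) fun h => ?_
  have htop := affineSpan_eq_top_of_notMem_degenerate (p := p) (I.sum_lam v)
    (s := I.verts.erase a) (fun b hb => ?_) (by rwa [I.sum_lam_smul_self])
  · have hle : affineSpan ℝ (Set.range fun i : I.verts.erase a => p i) ≤
        (AffineSubspace.mk' (0 : ℝ) (⊥ : Submodule ℝ ℝ)).comap (I.lam a) := by
      rw [affineSpan_le]
      rintro _ ⟨i, rfl⟩
      have hi := Finset.mem_erase.1 i.2
      have : I.lam a (p i) = 0 := by rw [I.lam_apply_vertex hi.2, if_neg hi.1.symm]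
      simp [this]
    rw [htop] at hle
    have h1 : p a ∈ _ := hle (AffineSubspace.mem_top ℝ E (p a))
    have h2 : I.lam a (p a) = 1 := by simp [I.lam_apply_vertex ha]
    simp [h2] at h1
  · by_cases hba : b = a
    · rw [hba, ← h]
    · rw [I.lam_of_notMem (fun hb' => hb (Finset.mem_erase.2 ⟨hba, hb'⟩))]; rfl

theorem Cell.card_verts [FiniteDimensional ℝ E] (I : Cell p) :
    I.verts.card = finrank ℝ E + 1 := by
  have := I.basis.card_eq_finrank_add_one
  simpa using this

/-- A spanning set of the right cardinality is a cell. -/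
theorem exists_cell_of_card [FiniteDimensional ℝ E] {s : Finset A}
    (hs : affineSpan ℝ (Set.range fun i : s => p i) = ⊤) (hc : s.card = finrank ℝ E + 1) :
    ∃ I : Cell p, I.verts = s := by
  refine ⟨⟨s, ?_, hs⟩, rfl⟩
  rw [affineIndependent_iff_finrank_vectorSpan_eq ℝ _ (n := finrank ℝ E) (by simpa using hc),
    ← direction_affineSpan, hs, AffineSubspace.direction_top, finrank_top]

/-- One step of the simplex method: a cell that is not optimal can be improved. -/
theorem Cell.exists_interp_lt [Fintype A] [FiniteDimensional ℝ E] (I : Cell p) {ω : A → ℝ}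
    (hI : ¬ I.Optimal ω) {v : E} (hv : v ∉ degenerate p) (hvI : v ∈ I.simplex) :
    ∃ J : Cell p, v ∈ J.simplex ∧ J.interp ω v < I.interp ω v := by
  classical
  simp only [Cell.Optimal, not_forall, not_le] at hI
  obtain ⟨a, ha⟩ := hI
  have haI : a ∉ I.verts := fun h => by simp [I.interp_vertex ω h] at ha
  -- Ratio test: `a` enters and the vertex of least ratio leaves. A positive coordinate of `p a`
  -- exists because the coordinates sum to 1.
  obtain ⟨i₀, hi₀, hmin⟩ := (I.verts.filter fun i => 0 < I.lam i (p a)).exists_min_image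
    (fun i => I.lam i v / I.lam i (p a)) (by
      by_contra hne
      rw [Finset.not_nonempty_iff_eq_empty, Finset.filter_eq_empty_iff] at hne
      have : ∑ b, I.lam b (p a) ≤ 0 := Finset.sum_nonpos fun b _ => by
        by_cases hb : b ∈ I.verts
        · exact not_lt.1 (hne hb)
        · simp [I.lam_of_notMem hb]
      rw [I.sum_lam] at this
      linarith)
  obtain ⟨hi₀I, hc₀⟩ := Finset.mem_filter.1 hi₀
  have hv₀ := I.lam_pos hv hvI hi₀I
  set t := I.lam i₀ v / I.lam i₀ (p a) with ht
  have htpos : 0 < t := div_pos hv₀ hc₀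
  -- These weights represent `v` after `t` times the expansion of `p a` is traded for weight `t` on
  -- `a` itself. The choice of `t` kills the weight of `i₀` and keeps the others nonnegative.
  set y : A → ℝ := fun b => I.lam b v - t * I.lam b (p a) + if b = a then t else 0 with hy
  have hy1 : ∑ b, y b = 1 := by
    simp [hy, Finset.sum_add_distrib, ← Finset.mul_sum, I.sum_lam]
  have hyv : ∑ b, y b • p b = v := by
    simp only [hy, add_smul, sub_smul, Finset.sum_add_distrib, Finset.sum_sub_distrib, mul_smul,
      ← Finset.smul_sum, I.sum_lam_smul_self, ite_smul, zero_smul]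
    simp
  have hy0 : ∀ b, 0 ≤ y b := by
    intro b
    by_cases hb : b ∈ I.verts
    · have hba : b ≠ a := fun h => haI (h ▸ hb)
      simp only [hy, if_neg hba, add_zero, sub_nonneg]
      by_cases hc : 0 < I.lam b (p a)
      · exact (le_div_iff₀ hc).1 (hmin b (Finset.mem_filter.2 ⟨hb, hc⟩))
      · exact (mul_nonpos_of_nonneg_of_nonpos htpos.le (not_lt.1 hc)).trans (hvI b)
    · simp only [hy, I.lam_of_notMem hb]
      split_ifs <;> simp [htpos.le]
  set s := insert a (I.verts.erase i₀) with hs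
  have hys : ∀ b ∉ s, y b = 0 := by
    intro b hb
    simp only [hs, Finset.mem_insert, Finset.mem_erase, not_or, not_and_or, not_not] at hb
    simp only [hy, if_neg hb.1, add_zero]
    rcases hb.2 with rfl | hb'
    · rw [ht]; field_simp; simp
    · simp [I.lam_of_notMem hb']
  have hspan := affineSpan_eq_top_of_notMem_degenerate hy1 hys (by rwa [hyv])
  obtain ⟨J, hJ⟩ := exists_cell_of_card hspan (by
    rw [hs, Finset.card_insert_of_notMem (fun h => haI (Finset.mem_of_mem_erase h)),
      Finset.card_erase_of_mem hi₀I, ← I.card_verts]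
    exact Nat.sub_add_cancel (Finset.card_pos.2 ⟨i₀, hi₀I⟩))
  have hlam : ∀ b, J.lam b v = y b := fun b => by
    rw [← hyv]
    exact J.lam_unique hy1 (hJ ▸ hys) b
  refine ⟨J, fun b => by rw [hlam]; exact hy0 b, ?_⟩
  -- The pivot changes the height by `t` times the reduced cost, which is negative since `a`
  -- violates optimality.
  have h1 : J.interp ω v = I.interp ω v + t * (ω a - I.interp ω (p a)) := by
    simp only [Cell.interp_apply, hlam, hy, mul_add, mul_sub, Finset.sum_add_distrib,
      Finset.sum_sub_distrib, Finset.mul_sum]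
    simp only [mul_ite, mul_zero, Finset.sum_ite_eq', Finset.mem_univ, if_true]
    have : ∀ b, ω b * (t * I.lam b (p a)) = t * (ω b * I.lam b (p a)) := fun b => by ring
    simp only [this]
    ring
  rw [h1]
  have := mul_neg_of_pos_of_neg htpos (sub_neg.2 ha)
  linarith

theorem sum_ite_image_smul [Fintype A] [DecidableEq A] {X V : Type*} [AddCommGroup V]
    [Module ℝ V] {q : A → X} {t : Finset X} {g : X → A} (hinj : Set.InjOn g t)
    (hg : ∀ e ∈ t, q (g e) = e) (c : X → ℝ) (F : A → V) :
    ∑ a, (if a ∈ t.image g then c (q a) else 0) • F a = ∑ e ∈ t, c e • F (g e) := by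
  rw [← Finset.sum_subset (Finset.subset_univ (t.image g)), Finset.sum_image hinj]
  · refine Finset.sum_congr rfl fun e he => ?_
    rw [if_pos (Finset.mem_image_of_mem g he), hg e he]
  · intro a _ ha
    rw [if_neg ha, zero_smul]

/-- Carathéodory's theorem gives an affinely independent set of points, and nondegeneracy of `v`
makes it full-dimensional. The choice `g` of indices is needed because `p` may repeat points. -/
theorem exists_cell_mem_simplex [Fintype A] [FiniteDimensional ℝ E] {v : E} (hv : v ∉ degenerate p)
    (hvp : v ∈ convexHull ℝ (Set.range p)) : ∃ I : Cell p, v ∈ I.simplex := by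
  classical
  rw [convexHull_eq_union] at hvp
  simp only [Set.mem_iUnion] at hvp
  obtain ⟨t, htp, hind, hvt⟩ := hvp
  have : Nonempty A := by
    obtain ⟨e, he⟩ := convexHull_nonempty_iff.1 ⟨v, hvt⟩
    exact ⟨(htp he).choose⟩
  have htp' : ∀ e ∈ t, ∃ a, p a = e := fun e he => htp he
  choose! g hg using htp'
  have hg' : ∀ i : t.image g, p i ∈ t := by
    rintro ⟨_, hi⟩
    obtain ⟨e, he, rfl⟩ := Finset.mem_image.1 hi
    simpa [hg _ he] using he
  let f : t.image g ↪ t := ⟨fun i => ⟨p i, hg' i⟩, by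
    rintro ⟨_, hi⟩ ⟨_, hj⟩ h
    obtain ⟨e, he, rfl⟩ := Finset.mem_image.1 hi
    obtain ⟨e', he', rfl⟩ := Finset.mem_image.1 hj
    simp only [hg _ he, hg _ he', Subtype.mk.injEq] at h
    subst h
    rfl⟩
  have hind' : AffineIndependent ℝ fun i : t.image g => p i := hind.comp_embedding f
  obtain ⟨c, hc0, hc1, hcv⟩ := Finset.mem_convexHull'.1 hvt
  have hinj : Set.InjOn g t := by
    intro e he e' he' h
    rw [← hg _ he, ← hg _ he', h]
  let y : A → ℝ := fun a => if a ∈ t.image g then c (p a) else 0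
  have hy1 : ∑ a, y a = 1 := by
    have := sum_ite_image_smul hinj hg c (fun _ => (1 : ℝ))
    simp only [smul_eq_mul, mul_one] at this
    exact this.trans hc1
  have hyv : ∑ a, y a • p a = v := by
    refine (sum_ite_image_smul hinj hg c p).trans ?_
    rw [← hcv]
    exact Finset.sum_congr rfl fun e he => by rw [hg e he]
  have hys : ∀ a ∉ t.image g, y a = 0 := fun a ha => if_neg ha
  have htop := affineSpan_eq_top_of_notMem_degenerate hy1 hys (by rwa [hyv])
  refine ⟨⟨t.image g, hind', htop⟩, fun a => ?_⟩
  rw [← hyv, Cell.lam_unique _ hy1 hys]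
  by_cases ha : a ∈ t.image g
  · simp only [y, if_pos ha]
    exact hc0 _ (hg' ⟨a, ha⟩)
  · simp only [y, if_neg ha, le_refl]

/-- Among the finitely many cells through `v`, one of least height over `v` is optimal, since
otherwise a pivot would lower it. -/
theorem exists_optimal_cell_of_notMem_degenerate [Fintype A] [FiniteDimensional ℝ E] (ω : A → ℝ) {v : E}
    (hv : v ∉ degenerate p) (hvp : v ∈ convexHull ℝ (Set.range p)) :
    ∃ I : Cell p, I.Optimal ω ∧ v ∈ I.simplex := by
  classical
  obtain ⟨I₀, hI₀⟩ := exists_cell_mem_simplex hv hvp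
  obtain ⟨I, hI, hmin⟩ := (Finset.univ.filter fun I : Cell p => v ∈ I.simplex).exists_min_image
    (fun I => I.interp ω v) ⟨I₀, by simpa using hI₀⟩
  simp only [Finset.mem_filter, Finset.mem_univ, true_and] at hI hmin
  refine ⟨I, ?_, hI⟩
  by_contra hopt
  obtain ⟨J, hJ, hlt⟩ := I.exists_interp_lt hopt hv hI
  exact absurd (hmin J hJ) (not_le.2 hlt)

theorem measure_degenerate [Fintype A] [FiniteDimensional ℝ E] [MeasurableSpace E] [BorelSpace E]
    (μ : Measure E) [μ.IsAddHaarMeasure] : μ (degenerate p) = 0 :=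
  (measure_biUnion_null_iff (Set.to_countable _)).2
    fun _ hs => Measure.addHaar_affineSubspace μ _ hs

/-- The optimal cells cover the polytope. -/
theorem exists_optimal_cell [Fintype A] [FiniteDimensional ℝ E]
    (hp : (interior (convexHull ℝ (Set.range p))).Nonempty) (ω : A → ℝ) {v : E}
    (hvp : v ∈ convexHull ℝ (Set.range p)) : ∃ I : Cell p, I.Optimal ω ∧ v ∈ I.simplex := by
  borelize E
  -- The degenerate points form a null set, so their complement is dense. The finitely many closed
  -- optimal simplices cover the nondegenerate interior points, hence their closure, which contains
  -- the polytope.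
  have hd : Dense (degenerate p)ᶜ := by
    have : ∀ᵐ x ∂(Measure.addHaar : Measure E), x ∉ degenerate p :=
      measure_eq_zero_iff_ae_notMem.1 (measure_degenerate _)
    exact Measure.dense_of_ae this
  have hsub : interior (convexHull ℝ (Set.range p)) ∩ (degenerate p)ᶜ ⊆
      ⋃ I : {I : Cell p // I.Optimal ω}, I.1.simplex := by
    rintro x ⟨hx, hxd⟩
    obtain ⟨I, hI, hxI⟩ := exists_optimal_cell_of_notMem_degenerate ω hxd (interior_subset hx)
    exact Set.mem_iUnion.2 ⟨⟨I, hI⟩, hxI⟩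
  have hcl : IsClosed (⋃ I : {I : Cell p // I.Optimal ω}, I.1.simplex) :=
    isClosed_iUnion_of_finite fun I => I.1.isClosed_simplex
  have h1 : v ∈ closure (interior (convexHull ℝ (Set.range p))) := by
    rw [(convex_convexHull ℝ _).closure_interior_eq_closure_of_nonempty_interior hp]
    exact subset_closure hvp
  have h2 := closure_minimal (hd.open_subset_closure_inter isOpen_interior) isClosed_closure h1
  obtain ⟨I, hI⟩ := Set.mem_iUnion.1 (closure_minimal hsub hcl h2)
  exact ⟨I.1, I.2, hI⟩

end Cells

set_option linter.unusedSectionVars false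

/-! ### Fiberwise minimizers and integrals of sections -/

section Sections

open Module MeasureTheory

variable {A M E : Type*} [Fintype A] [NormedAddCommGroup M] [NormedSpace ℝ M]
  [NormedAddCommGroup E] [NormedSpace ℝ E] {pt : A → M} {π : M →ₗ[ℝ] E}

/-- The lift of a point by barycentric coordinates with respect to a cell. -/
noncomputable def Cell.lift (I : Cell fun a => π (pt a)) (x : E) : M := ∑ a, I.lam a x • pt a

theorem Cell.lift_mem (I : Cell fun a => π (pt a)) {x : E} (hx : x ∈ I.simplex) :
    I.lift x ∈ convexHull ℝ (Set.range pt) :=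
  (convex_convexHull ℝ _).sum_mem (fun a _ => hx a) (I.sum_lam x)
    fun a _ => subset_convexHull ℝ _ ⟨a, rfl⟩

theorem Cell.map_lift (I : Cell fun a => π (pt a)) (x : E) : π (I.lift x) = x := by
  simpa [Cell.lift] using I.sum_lam_smul_self x

theorem Cell.apply_lift (I : Cell fun a => π (pt a)) (f : M →ₗ[ℝ] ℝ) (x : E) :
    f (I.lift x) = I.interp (fun a => f (pt a)) x := by
  simp [Cell.lift, Cell.interp_apply, mul_comm]

theorem Cell.simplex_subset (I : Cell fun a => π (pt a)) :
    I.simplex ⊆ convexHull ℝ (Set.range fun a => π (pt a)) := fun x hx => by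
  rw [← I.sum_lam_smul_self x]
  exact (convex_convexHull ℝ _).sum_mem (fun a _ => hx a) (I.sum_lam x)
    fun a _ => subset_convexHull ℝ _ ⟨a, rfl⟩

theorem map_mem_convexHull {u : M} (hu : u ∈ convexHull ℝ (Set.range pt)) :
    π u ∈ convexHull ℝ (Set.range fun a => π (pt a)) := by
  have := Set.mem_image_of_mem π hu
  rwa [LinearMap.image_convexHull, ← Set.range_comp] at this

/-- The difference `f` minus the interpolation after `π` is affine and nonnegative at the
generators, hence on their hull. -/
theorem Cell.Optimal.interp_le {I : Cell fun a => π (pt a)} {f : M →ₗ[ℝ] ℝ}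
    (hI : I.Optimal fun a => f (pt a)) {u : M} (hu : u ∈ convexHull ℝ (Set.range pt)) :
    I.interp (fun a => f (pt a)) (π u) ≤ f u := by
  have hc : Convex ℝ {u : M | I.interp (fun a => f (pt a)) (π u) ≤ f u} := by
    have heq : {u : M | I.interp (fun a => f (pt a)) (π u) ≤ f u} =
        (f.toAffineMap - (I.interp fun a => f (pt a)).comp π.toAffineMap) ⁻¹' Set.Ici 0 := by
      ext u
      simp
    rw [heq]
    exact (convex_Ici (0 : ℝ)).affine_preimage _
  exact convexHull_min (by rintro _ ⟨a, rfl⟩; exact hI a) hc hu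

/-- The points of the polytope that minimize `f` over their fiber. -/
def fiberMin (pt : A → M) (π : M →ₗ[ℝ] E) (f : M →ₗ[ℝ] ℝ) : Set M :=
  {u | u ∈ convexHull ℝ (Set.range pt) ∧
    ∀ u' ∈ convexHull ℝ (Set.range pt), π u' = π u → f u ≤ f u'}

/-- The lower bound given by the interpolation depends on `π u` only, so a point attaining it is
minimal in its fiber. -/
theorem mem_fiberMin_of_optimal {f : M →ₗ[ℝ] ℝ} {I : Cell fun a => π (pt a)}
    (hI : I.Optimal fun a => f (pt a)) {u : M} (hu : u ∈ convexHull ℝ (Set.range pt))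
    (h : f u = I.interp (fun a => f (pt a)) (π u)) : u ∈ fiberMin pt π f :=
  ⟨hu, fun u' hu' hπ => by rw [h, ← hπ]; exact hI.interp_le hu'⟩

theorem Cell.Optimal.lift_mem_fiberMin {f : M →ₗ[ℝ] ℝ} {I : Cell fun a => π (pt a)}
    (hI : I.Optimal fun a => f (pt a)) {x : E} (hx : x ∈ I.simplex) :
    I.lift x ∈ fiberMin pt π f :=
  mem_fiberMin_of_optimal hI (I.lift_mem hx) (by rw [I.apply_lift, I.map_lift])

variable [FiniteDimensional ℝ E]

theorem exists_optimal_of_mem_fiberMin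
    (hp : (interior (convexHull ℝ (Set.range fun a => π (pt a)))).Nonempty)
    {f : M →ₗ[ℝ] ℝ} {u : M} (hu : u ∈ fiberMin pt π f) :
    ∃ I : Cell fun a => π (pt a), I.Optimal (fun a => f (pt a)) ∧ π u ∈ I.simplex ∧
      f u = I.interp (fun a => f (pt a)) (π u) := by
  obtain ⟨I, hI, huI⟩ := exists_optimal_cell hp (fun a => f (pt a)) (map_mem_convexHull hu.1)
  refine ⟨I, hI, huI, le_antisymm ?_ (hI.interp_le hu.1)⟩
  rw [← I.apply_lift]
  exact hu.2 _ (I.lift_mem huI) (I.map_lift _)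

/-- A point minimizes `f` over its fiber iff it minimizes some `f + h ∘ π` over the polytope. -/
theorem mem_fiberMin_iff
    (hp : (interior (convexHull ℝ (Set.range fun a => π (pt a)))).Nonempty)
    {f : M →ₗ[ℝ] ℝ} {u : M} :
    u ∈ fiberMin pt π f ↔ u ∈ convexHull ℝ (Set.range pt) ∧ ∃ h : E →ₗ[ℝ] ℝ,
      ∀ u' ∈ convexHull ℝ (Set.range pt), f u + h (π u) ≤ f u' + h (π u') := by
  constructor
  · intro hu
    obtain ⟨I, hI, -, hfu⟩ := exists_optimal_of_mem_fiberMin hp hu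
    set g := I.interp fun a => f (pt a)
    have hg : ∀ x, g x = g.linear x + g 0 := fun x => by simpa using g.map_vadd 0 x
    -- The dual certificate is minus the slope of the optimal interpolation: `f - g ∘ π` is
    -- nonnegative on the polytope and zero at `u`.
    refine ⟨hu.1, -g.linear, fun u' hu' => ?_⟩
    have h1 := hI.interp_le hu'
    change g _ ≤ _ at h1
    rw [hg] at h1 hfu
    simp only [LinearMap.neg_apply]
    linarith
  · rintro ⟨hu, h, hh⟩
    refine ⟨hu, fun u' hu' hπ => ?_⟩
    have := hh u' hu'
    rw [hπ] at this
    linarith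

variable [FiniteDimensional ℝ M] [MeasurableSpace E] [BorelSpace E]

theorem Cell.continuous_lift (I : Cell fun a => π (pt a)) : Continuous (I.lift (pt := pt)) :=
  continuous_finsetSum _ fun a _ => (I.lam_continuous a).smul continuous_const

/-- A measurable selection from the lifts of finitely many cells. -/
theorem exists_measurable_selection [MeasurableSpace M] [BorelSpace M]
    (T : Finset (Cell fun a => π (pt a))) :
    ∃ γ : E → M, Measurable γ ∧ ∀ x, (∃ I ∈ T, x ∈ I.simplex) →
      ∃ I ∈ T, x ∈ I.simplex ∧ γ x = I.lift x := by
  classical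
  induction T using Finset.induction_on with
  | empty => exact ⟨0, measurable_zero, by simp⟩
  | insert I T _ ih =>
    obtain ⟨γ, hγ, h⟩ := ih
    refine ⟨I.simplex.piecewise I.lift γ,
      Measurable.piecewise I.isClosed_simplex.measurableSet I.continuous_lift.measurable hγ, ?_⟩
    rintro x ⟨J, hJ, hx⟩
    by_cases hxI : x ∈ I.simplex
    · exact ⟨I, Finset.mem_insert_self _ _, hxI, by simp [hxI]⟩
    · rcases Finset.mem_insert.1 hJ with rfl | hJ
      · exact absurd hx hxI
      · obtain ⟨J', hJ', hx', he⟩ := h x ⟨J, hJ, hx⟩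
        exact ⟨J', Finset.mem_insert_of_mem hJ', hx', by simp [hxI, he]⟩

/-- The integrable sections of the projection of a polytope along `π`. -/
structure IsFiberSection (pt : A → M) (π : M →ₗ[ℝ] E) (μ : Measure E) (γ : E → M) : Prop where
  integrableOn : IntegrableOn γ (convexHull ℝ (Set.range fun a => π (pt a))) μ
  mem : ∀ x ∈ convexHull ℝ (Set.range fun a => π (pt a)), γ x ∈ convexHull ℝ (Set.range pt)
  map : ∀ x ∈ convexHull ℝ (Set.range fun a => π (pt a)), π (γ x) = x

theorem isCompact_convexHull_range {V : Type*} [NormedAddCommGroup V] [NormedSpace ℝ V]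
    (q : A → V) : IsCompact (convexHull ℝ (Set.range q)) :=
  (Set.finite_range q).isCompact_convexHull (𝕜 := ℝ)

variable (μ : Measure E) [μ.IsAddHaarMeasure]

theorem isFiberSection_of_measurable [MeasurableSpace M] [BorelSpace M] {γ : E → M}
    (hγ : Measurable γ)
    (hmem : ∀ x ∈ convexHull ℝ (Set.range fun a => π (pt a)), γ x ∈ convexHull ℝ (Set.range pt))
    (hmap : ∀ x ∈ convexHull ℝ (Set.range fun a => π (pt a)), π (γ x) = x) :
    IsFiberSection pt π μ γ := by
  obtain ⟨C, hC⟩ := (isCompact_convexHull_range pt).isBounded.exists_norm_le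
  have hD := isCompact_convexHull_range fun a => π (pt a)
  refine ⟨Measure.integrableOn_of_bounded (M := C) hD.measure_lt_top.ne
    hγ.aestronglyMeasurable ?_, hmem, hmap⟩
  filter_upwards [ae_restrict_mem hD.measurableSet] with x hx
  exact hC _ (hmem x hx)

/-- There is a measurable section that minimizes `f` on every fiber. -/
theorem exists_section_fiberMin [MeasurableSpace M] [BorelSpace M]
    (hp : (interior (convexHull ℝ (Set.range fun a => π (pt a)))).Nonempty) (f : M →ₗ[ℝ] ℝ) :
    ∃ γ : E → M, Measurable γ ∧ IsFiberSection pt π μ γ ∧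
      ∀ x ∈ convexHull ℝ (Set.range fun a => π (pt a)), γ x ∈ fiberMin pt π f := by
  classical
  obtain ⟨γ, hγ, h⟩ := exists_measurable_selection
    (Finset.univ.filter fun I : Cell fun a => π (pt a) => I.Optimal fun a => f (pt a))
  have key : ∀ x ∈ convexHull ℝ (Set.range fun a => π (pt a)),
      γ x ∈ fiberMin pt π f ∧ π (γ x) = x := by
    intro x hx
    obtain ⟨I, hI, hxI⟩ := exists_optimal_cell hp (fun a => f (pt a)) hx
    obtain ⟨J, hJ, hxJ, he⟩ := h x ⟨I, by simpa using hI, hxI⟩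
    rw [he]
    exact ⟨Cell.Optimal.lift_mem_fiberMin (by simpa using hJ) hxJ, J.map_lift x⟩
  exact ⟨γ, hγ, isFiberSection_of_measurable μ hγ (fun x hx => (key x hx).1.1)
    fun x hx => (key x hx).2, fun x hx => (key x hx).1⟩

theorem apply_setIntegral {D : Set E} {γ : E → M} (hγ : IntegrableOn γ D μ) (f : M →ₗ[ℝ] ℝ) :
    f (∫ x in D, γ x ∂μ) = ∫ x in D, f (γ x) ∂μ :=
  ((LinearMap.toContinuousLinearMap f).integral_comp_comm hγ).symm

theorem integrableOn_apply {D : Set E} {γ : E → M} (hγ : IntegrableOn γ D μ) (f : M →ₗ[ℝ] ℝ) :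
    IntegrableOn (fun x => f (γ x)) D μ :=
  (LinearMap.toContinuousLinearMap f).integrable_comp hγ

variable {μ}

theorem IsFiberSection.le_of_ae {γ γ' : E → M} (hγ : IsFiberSection pt π μ γ)
    (hγ' : IsFiberSection pt π μ γ') {f : M →ₗ[ℝ] ℝ}
    (h : ∀ᵐ x ∂μ.restrict (convexHull ℝ (Set.range fun a => π (pt a))), γ x ∈ fiberMin pt π f) :
    f (∫ x in convexHull ℝ (Set.range fun a => π (pt a)), γ x ∂μ) ≤
      f (∫ x in convexHull ℝ (Set.range fun a => π (pt a)), γ' x ∂μ) := by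
  rw [apply_setIntegral μ hγ.1, apply_setIntegral μ hγ'.1]
  refine integral_mono_ae (integrableOn_apply μ hγ.1 f) (integrableOn_apply μ hγ'.1 f) ?_
  filter_upwards [h, ae_restrict_mem (isCompact_convexHull_range _).measurableSet] with x hx hxD
  exact hx.2 _ (hγ'.mem x hxD) (by rw [hγ'.map x hxD, hγ.map x hxD])

/-- Against a fiberwise minimal section, the excess of `f` is nonnegative with integral at most
zero, so it vanishes almost everywhere. -/
theorem IsFiberSection.ae_of_le [MeasurableSpace M] [BorelSpace M]
    (hp : (interior (convexHull ℝ (Set.range fun a => π (pt a)))).Nonempty) {γ : E → M}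
    (hγ : IsFiberSection pt π μ γ) {f : M →ₗ[ℝ] ℝ}
    (h : ∀ γ', IsFiberSection pt π μ γ' →
      f (∫ x in convexHull ℝ (Set.range fun a => π (pt a)), γ x ∂μ) ≤
        f (∫ x in convexHull ℝ (Set.range fun a => π (pt a)), γ' x ∂μ)) :
    ∀ᵐ x ∂μ.restrict (convexHull ℝ (Set.range fun a => π (pt a))), γ x ∈ fiberMin pt π f := by
  obtain ⟨γ', -, hγ', hmin⟩ := exists_section_fiberMin (pt := pt) (π := π) μ hp f
  have hD := (isCompact_convexHull_range fun a => π (pt a)).measurableSet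
  have h1 := h γ' hγ'
  rw [apply_setIntegral μ hγ.1, apply_setIntegral μ hγ'.1] at h1
  have hi := integrableOn_apply μ hγ.1 f
  have hi' := integrableOn_apply μ hγ'.1 f
  have hnn : 0 ≤ᵐ[μ.restrict (convexHull ℝ (Set.range fun a => π (pt a)))]
      fun x => f (γ x) - f (γ' x) := by
    filter_upwards [ae_restrict_mem hD] with x hx
    exact sub_nonneg.2 ((hmin x hx).2 _ (hγ.mem x hx) (by rw [hγ'.map x hx, hγ.map x hx]))
  have h0 : ∫ x in convexHull ℝ (Set.range fun a => π (pt a)), (f (γ x) - f (γ' x)) ∂μ = 0 := by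
    refine le_antisymm ?_ (integral_nonneg_of_ae hnn)
    rw [integral_sub hi hi']
    linarith
  have h2 := (integral_eq_zero_iff_of_nonneg_ae hnn (hi.sub hi')).1 h0
  filter_upwards [h2, ae_restrict_mem hD] with x hx hxD
  refine ⟨hγ.mem x hxD, fun u' hu' hπ => ?_⟩
  have h3 : f (γ x) = f (γ' x) := sub_eq_zero.1 hx
  rw [h3]
  exact (hmin x hxD).2 u' hu' (by rw [hπ, hγ'.map x hxD, hγ.map x hxD])

theorem Cell.exists_isOpen_subset_simplex {p : A → E} (I : Cell p) :
    ∃ U ⊆ I.simplex, IsOpen U ∧ U.Nonempty := by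
  classical
  refine ⟨⋂ a ∈ I.verts, {x | 0 < I.lam a x}, ?_, ?_, ?_⟩
  · intro x hx a
    by_cases ha : a ∈ I.verts
    · exact (Set.mem_iInter₂.1 hx a ha).le
    · simp [I.lam_of_notMem ha]
  · exact isOpen_biInter_finset fun a _ => isOpen_lt continuous_const (I.lam_continuous a)
  · have hcard : (0 : ℝ) < I.verts.card := by rw [I.card_verts]; positivity
    let y : A → ℝ := fun a => if a ∈ I.verts then (I.verts.card : ℝ)⁻¹ else 0
    have hy : ∑ a, y a = 1 := by
      simp [y, hcard.ne']
    refine ⟨∑ a, y a • p a, Set.mem_iInter₂.2 fun a ha => ?_⟩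
    change 0 < I.lam a _
    rw [I.lam_unique hy (fun b hb => if_neg hb)]
    simp only [y, if_pos ha]
    positivity

variable (μ)

/-- The comparison of fiberwise minimizers is the comparison of the sections with minimal
integral. -/
theorem fiberMin_subset_iff [MeasurableSpace M] [BorelSpace M]
    (hp : (interior (convexHull ℝ (Set.range fun a => π (pt a)))).Nonempty)
    (f g : M →ₗ[ℝ] ℝ) :
    fiberMin pt π f ⊆ fiberMin pt π g ↔
      ∀ γ, IsFiberSection pt π μ γ →
        (∀ γ', IsFiberSection pt π μ γ' →
          f (∫ x in convexHull ℝ (Set.range fun a => π (pt a)), γ x ∂μ) ≤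
            f (∫ x in convexHull ℝ (Set.range fun a => π (pt a)), γ' x ∂μ)) →
        ∀ γ', IsFiberSection pt π μ γ' →
          g (∫ x in convexHull ℝ (Set.range fun a => π (pt a)), γ x ∂μ) ≤
            g (∫ x in convexHull ℝ (Set.range fun a => π (pt a)), γ' x ∂μ) := by
  classical
  constructor
  · intro hsub γ hγ hmin γ' hγ'
    exact hγ.le_of_ae hγ' ((hγ.ae_of_le hp hmin).mono fun x hx => hsub hx)
  -- Integrals do not see the single point `u`, so it is spread over a set `T` of positive measure:
  -- midpoints of `u` with the lift of an optimal cell through `π u` still minimize `f`. Replacing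
  -- an `f`-minimal section by these over `T` keeps it minimal, so some midpoint also minimizes `g`.
  -- A competitor of `u` then yields a competitor of that midpoint.
  · intro h u hu
    obtain ⟨I, hI, huI, hfu⟩ := exists_optimal_of_mem_fiberMin hp hu
    obtain ⟨γ₀, hγ₀, hs₀, hm₀⟩ := exists_section_fiberMin (pt := pt) (π := π) μ hp f
    set v := π u with hv
    -- points half way between `u` and the lift of the cell
    let T : Set E := (fun x => (2 : ℝ) • x - v) ⁻¹' I.simplex
    have hcont : Continuous fun x : E => (2 : ℝ) • x - v := by fun_prop
    have hT : MeasurableSet T := (I.isClosed_simplex.preimage hcont).measurableSet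
    let γ₁ : E → M := fun x => (2⁻¹ : ℝ) • u + (2⁻¹ : ℝ) • I.lift ((2 : ℝ) • x - v)
    have hγ₁ : Measurable γ₁ := by
      have : Continuous γ₁ :=
        continuous_const.add ((I.continuous_lift.comp hcont).const_smul _)
      exact this.measurable
    have hK := convex_convexHull ℝ (Set.range pt)
    have hT1 : ∀ x, π (γ₁ x) = x := by
      intro x
      simp only [γ₁, map_add, map_smul, I.map_lift, ← hv, smul_sub, smul_smul]
      norm_num
    have hmemK : ∀ x ∈ T, γ₁ x ∈ convexHull ℝ (Set.range pt) := fun x hx =>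
      hK hu.1 (I.lift_mem hx) (by norm_num) (by norm_num) (by norm_num)
    have hT2 : ∀ x ∈ T, γ₁ x ∈ fiberMin pt π f := by
      intro x hx
      refine mem_fiberMin_of_optimal hI (hmemK x hx) ?_
      rw [hT1]
      simp only [γ₁, map_add, map_smul, I.apply_lift, hfu, smul_eq_mul]
      set ℓ := I.interp fun a => f (pt a)
      have hℓ : ∀ x, ℓ x = ℓ.linear x + ℓ 0 := fun x => by simpa using ℓ.map_vadd 0 x
      rw [hℓ v, hℓ (_ - v), hℓ x, map_sub, map_smul, smul_eq_mul]
      ring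
    have hγ : IsFiberSection pt π μ (T.piecewise γ₁ γ₀) := by
      refine isFiberSection_of_measurable μ (hγ₁.piecewise hT hγ₀) ?_ ?_ <;>
      · intro x hx
        by_cases hxT : x ∈ T
        · simp [hxT, hmemK, hT1]
        · simp [hxT, hs₀.mem x hx, hs₀.map x hx]
    have hae := hγ.ae_of_le hp (h _ hγ fun γ' hγ' => hγ.le_of_ae hγ' (by
      filter_upwards [ae_restrict_mem (isCompact_convexHull_range _).measurableSet] with x hx
      by_cases hxT : x ∈ T
      · simpa [hxT] using hT2 x hxT
      · simpa [hxT] using hm₀ x hx))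
    have hTD : T ⊆ convexHull ℝ (Set.range fun a => π (pt a)) := fun x hx => by
      rw [← hT1 x]
      exact map_mem_convexHull (hmemK x hx)
    have hTpos : 0 < μ T := by
      obtain ⟨U, hUI, hU, y, hy⟩ := I.exists_isOpen_subset_simplex
      refine ((hU.preimage hcont).measure_pos μ ⟨(2⁻¹ : ℝ) • (y + v), ?_⟩).trans_le
        (measure_mono (Set.preimage_mono hUI))
      simpa [smul_smul] using hy
    obtain ⟨x, hxT, hx⟩ : ∃ x ∈ T, T.piecewise γ₁ γ₀ x ∈ fiberMin pt π g := by
      by_contra! hcon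
      refine hTpos.ne' (measure_mono_null (t := {x | x ∈ convexHull ℝ
        (Set.range fun a => π (pt a)) ∧ T.piecewise γ₁ γ₀ x ∉ fiberMin pt π g})
        (fun x hx => ⟨hTD hx, hcon x hx⟩) ?_)
      rw [ae_restrict_iff' (isCompact_convexHull_range _).measurableSet, ae_iff] at hae
      simpa using hae
    simp only [Set.piecewise, hxT, if_true] at hx
    refine ⟨hu.1, fun u' hu' hπ => ?_⟩
    have h1 := hx.2 ((2⁻¹ : ℝ) • u' + (2⁻¹ : ℝ) • I.lift ((2 : ℝ) • x - v))
      (hK hu' (I.lift_mem hxT) (by norm_num) (by norm_num) (by norm_num))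
      (by simp [γ₁, hπ])
    simp only [γ₁, map_add, map_smul, smul_eq_mul] at h1
    linarith

end Sections

/-! ### Integrals of barycentric coordinates over lattice simplices -/

section SimplexIntegral

open MeasureTheory

theorem lintegral_Ici_ofReal_sub_pow (n : ℕ) (t : ℝ) :
    ∫⁻ s in Set.Ici (0 : ℝ), ENNReal.ofReal (max (t - s) 0 ^ (n + 1) / (n + 1).factorial) =
      ENNReal.ofReal (max t 0 ^ (n + 2) / (n + 2).factorial) := by
  rcases le_or_gt t 0 with ht | ht
  · rw [max_eq_right ht, setLIntegral_congr_fun (g := fun _ => 0) measurableSet_Ici]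
    · simp
    · intro s hs
      have : t - s ≤ 0 := by have : (0 : ℝ) ≤ s := hs; linarith
      simp [max_eq_right this]
  · have h1 : ∫⁻ s in Set.Ici (0 : ℝ),
        ENNReal.ofReal (max (t - s) 0 ^ (n + 1) / (n + 1).factorial) =
        ∫⁻ s in Set.Ioc 0 t, ENNReal.ofReal (max (t - s) 0 ^ (n + 1) / (n + 1).factorial) := by
      rw [setLIntegral_congr (Ioi_ae_eq_Ici (μ := volume) (a := (0 : ℝ))).symm,
        ← Set.Ioc_union_Ioi_eq_Ioi ht.le,
        lintegral_union measurableSet_Ioi (Set.Ioc_disjoint_Ioi le_rfl)]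
      rw [setLIntegral_congr_fun (s := Set.Ioi t) (g := fun _ => 0) measurableSet_Ioi]
      · simp
      · intro s hs
        have : t - s ≤ 0 := by have : t < s := hs; linarith
        simp [max_eq_right this]
    have hc : Continuous fun s : ℝ => max (t - s) 0 ^ (n + 1) / ((n + 1).factorial : ℝ) := by
      fun_prop
    have h2 : ∫ s in Set.Ioc 0 t, max (t - s) 0 ^ (n + 1) / ((n + 1).factorial : ℝ) =
        t ^ (n + 2) / (n + 2).factorial := by
      rw [← intervalIntegral.integral_of_le ht.le]
      have : ∫ s in (0 : ℝ)..t, max (t - s) 0 ^ (n + 1) / ((n + 1).factorial : ℝ) =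
          ∫ s in (0 : ℝ)..t, (fun x : ℝ => x ^ (n + 1) / ((n + 1).factorial : ℝ)) (t - s) := by
        refine intervalIntegral.integral_congr fun s hs => ?_
        rw [Set.uIcc_of_le ht.le] at hs
        simp [max_eq_left (sub_nonneg.2 hs.2)]
      rw [this, intervalIntegral.integral_comp_sub_left
        (fun x : ℝ => x ^ (n + 1) / ((n + 1).factorial : ℝ)), sub_self, sub_zero,
        intervalIntegral.integral_div, integral_pow, Nat.factorial_succ (n + 1)]
      push_cast
      field_simp
      ring
    rw [h1, max_eq_left ht.le, ← h2, ofReal_integral_eq_lintegral_ofReal]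
    · exact (hc.integrableOn_Icc).mono_set Set.Ioc_subset_Icc_self
    · exact Filter.Eventually.of_forall fun s => by positivity

/-- Induction on `d` by slicing along the first coordinate, for all `t` at once because slicing
replaces `t` by `t - s`. `ENNReal.ofReal` truncates negative values, so the facet where the
coordinates sum to `t` needs no indicator, and Tonelli needs no integrability. -/
theorem lintegral_corner (d : ℕ) (t : ℝ) :
    ∫⁻ y : Fin d → ℝ, (Set.Ici 0).indicator (fun y => ENNReal.ofReal (t - ∑ i, y i)) y =
      ENNReal.ofReal (max t 0 ^ (d + 1) / (d + 1).factorial) := by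
  induction d generalizing t with
  | zero =>
    rw [lintegral_unique, volume_pi, Measure.pi_of_empty]
    simp [ENNReal.ofReal_max]
  | succ d ih =>
    have hmeas : ∀ (d : ℕ) (t : ℝ), Measurable
        ((Set.Ici (0 : Fin d → ℝ)).indicator fun y => ENNReal.ofReal (t - ∑ i, y i)) := by
      intro d t
      refine Measurable.indicator (by fun_prop) measurableSet_Ici
    have hmp := (volume_preserving_piFinSuccAbove (fun _ : Fin (d + 1) => ℝ) 0).symm
    rw [← hmp.lintegral_comp (hmeas _ _), Measure.volume_eq_prod, lintegral_prod]
    · have hin : ∀ s : ℝ, (∫⁻ z : Fin d → ℝ, (Set.Ici (0 : Fin (d + 1) → ℝ)).indicator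
          (fun y => ENNReal.ofReal (t - ∑ i, y i))
          ((MeasurableEquiv.piFinSuccAbove (fun _ : Fin (d + 1) => ℝ) 0).symm (s, z))) =
          (Set.Ici (0 : ℝ)).indicator (fun s => ENNReal.ofReal
            (max (t - s) 0 ^ (d + 1) / (d + 1).factorial)) s := by
        intro s
        have hmem : ∀ z : Fin d → ℝ,
            (MeasurableEquiv.piFinSuccAbove (fun _ : Fin (d + 1) => ℝ) 0).symm (s, z) ∈
              Set.Ici (0 : Fin (d + 1) → ℝ) ↔ 0 ≤ s ∧ z ∈ Set.Ici (0 : Fin d → ℝ) := by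
          intro z
          simp [Pi.le_def, Fin.forall_fin_succ, MeasurableEquiv.piFinSuccAbove]
        by_cases hs : 0 ≤ s
        · rw [Set.indicator_of_mem (Set.mem_Ici.2 hs), ← ih]
          refine lintegral_congr fun z => ?_
          by_cases hz : z ∈ Set.Ici (0 : Fin d → ℝ)
          · rw [Set.indicator_of_mem ((hmem z).2 ⟨hs, hz⟩), Set.indicator_of_mem hz]
            simp [Fin.sum_univ_succ, MeasurableEquiv.piFinSuccAbove, sub_sub]
          · rw [Set.indicator_of_notMem (fun h => hz ((hmem z).1 h).2),
              Set.indicator_of_notMem hz]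
        · rw [Set.indicator_of_notMem (show s ∉ Set.Ici (0 : ℝ) from hs)]
          rw [lintegral_congr (g := fun _ => 0), lintegral_zero]
          intro z
          rw [Set.indicator_of_notMem (fun h => hs ((hmem z).1 h).1)]
      rw [lintegral_congr hin, lintegral_indicator measurableSet_Ici]
      exact lintegral_Ici_ofReal_sub_pow d t
    · exact ((hmeas _ _).comp hmp.measurable).aemeasurable

/-- The standard corner simplex. -/
def corner (d : ℕ) : Set (Fin d → ℝ) := {y | 0 ≤ y ∧ ∑ i, y i ≤ 1}

theorem measurableSet_corner (d : ℕ) : MeasurableSet (corner d) :=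
  measurableSet_Ici.inter (measurableSet_le
    (by fun_prop : Measurable fun y : Fin d → ℝ => ∑ i, y i) measurable_const)

theorem integral_corner (d : ℕ) :
    ∫ y in corner d, (1 - ∑ i, y i) = 1 / (d + 1).factorial := by
  rw [integral_eq_lintegral_of_nonneg_ae]
  · have : ∫⁻ y in corner d, ENNReal.ofReal (1 - ∑ i, y i) =
        ∫⁻ y : Fin d → ℝ, (Set.Ici 0).indicator (fun y => ENNReal.ofReal (1 - ∑ i, y i)) y := by
      rw [← lintegral_indicator (measurableSet_corner d)]
      refine lintegral_congr fun y => ?_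
      by_cases h0 : y ∈ Set.Ici (0 : Fin d → ℝ)
      · by_cases h1 : ∑ i, y i ≤ 1
        · rw [Set.indicator_of_mem (show y ∈ corner d from ⟨h0, h1⟩), Set.indicator_of_mem h0]
        · rw [Set.indicator_of_notMem (fun h => h1 h.2), Set.indicator_of_mem h0,
            ENNReal.ofReal_of_nonpos (by linarith)]
      · rw [Set.indicator_of_notMem (fun h => h0 h.1), Set.indicator_of_notMem h0]
    rw [this, lintegral_corner]
    rw [ENNReal.toReal_ofReal (by positivity)]
    simp
  · filter_upwards [ae_restrict_mem (measurableSet_corner d)] with y hy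
    exact sub_nonneg.2 hy.2
  · exact (by fun_prop : Measurable fun y : Fin d → ℝ => 1 - ∑ i, y i).aestronglyMeasurable

theorem mem_intLattice_iff {d : ℕ} {x : Fin d → ℝ} :
    x ∈ intLattice d ↔ ∃ n : Fin d → ℤ, ∀ j, x j = n j := by
  constructor
  · rintro ⟨n, rfl⟩
    exact ⟨n, fun j => rfl⟩
  · rintro ⟨n, hn⟩
    exact ⟨n, (funext hn).symm⟩

/-- The integral of a barycentric coordinate over a lattice simplex. -/
theorem Cell.exists_integral_lam {A : Type*} [Fintype A] {d : ℕ} {p : A → Fin d → ℝ}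
    (hp : ∀ a, p a ∈ intLattice d) (I : Cell p) (i : A) :
    ∃ k : ℤ, ((d + 1).factorial : ℝ) * ∫ x in I.simplex, I.lam i x = k := by
  classical
  by_cases hi : i ∈ I.verts
  swap
  · exact ⟨0, by simp [I.lam_of_notMem hi]⟩
  have hcard : (I.verts.erase i).card = d := by
    rw [Finset.card_erase_of_mem hi, I.card_verts]
    simp
  let e := (Finset.equivFinOfCardEq hcard).symm
  let b : Fin d → A := fun k => e k
  have hb : ∀ k, b k ∈ I.verts ∧ b k ≠ i := fun k =>
    ⟨(Finset.mem_erase.1 (e k).2).2, (Finset.mem_erase.1 (e k).2).1⟩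
  have hbinj : Function.Injective b := fun k l h => e.injective (Subtype.ext h)
  have hsum : ∀ {V : Type} [AddCommMonoid V] (F : A → V),
      ∑ a ∈ I.verts, F a = F i + ∑ k, F (b k) := by
    intro V _ F
    rw [← Finset.add_sum_erase _ _ hi, ← Finset.sum_coe_sort (I.verts.erase i)]
    congr 1
    exact (e.sum_comp fun a : I.verts.erase i => F a).symm
  have hsum' : ∀ {V : Type} [AddCommGroup V] [Module ℝ V] (F : A → V) (x : Fin d → ℝ),
      ∑ a, I.lam a x • F a = I.lam i x • F i + ∑ k, I.lam (b k) x • F (b k) := by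
    intro V _ _ F x
    rw [← hsum fun a => I.lam a x • F a]
    refine (Finset.sum_subset (Finset.subset_univ _) fun a _ ha => ?_).symm
    simp [I.lam_of_notMem ha]
  choose n hn using fun a => mem_intLattice_iff.1 (hp a)
  -- The columns are the edge vectors of the simplex at the vertex `i`, so the determinant is an
  -- integer.
  let Mz : Matrix (Fin d) (Fin d) ℤ := Matrix.of fun j k => n (b k) j - n i j
  let Mr : Matrix (Fin d) (Fin d) ℝ := Mz.map (Int.castRingHom ℝ)
  let Lr : (Fin d → ℝ) →L[ℝ] (Fin d → ℝ) := LinearMap.toContinuousLinearMap (Matrix.toLin' Mr)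
  have hdet : Lr.det = (Mz.det : ℝ) := by
    change LinearMap.det (Matrix.toLin' Mr) = _
    rw [LinearMap.det_toLin']
    exact ((Int.castRingHom ℝ).map_det Mz).symm
  have hL : ∀ y, Lr y = ∑ k, y k • (p (b k) - p i) := by
    intro y
    ext j
    change (Mr.mulVec y) j = _
    simp [Mr, Mz, Matrix.mulVec, dotProduct, hn, mul_comm]
  let ψ : (Fin d → ℝ) → (Fin d → ℝ) := fun y => Lr y + p i
  have hlin : ∀ a y, I.lam a (ψ y) =
      ∑ k, y k * (I.lam a (p (b k)) - I.lam a (p i)) + I.lam a (p i) := by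
    intro a y
    have h1 : I.lam a (ψ y) = (I.lam a).linear (Lr y) + I.lam a (p i) :=
      (I.lam a).map_vadd (p i) (Lr y)
    rw [h1, hL, map_sum]
    simp_rw [map_smul, smul_eq_mul]
    congr 1
    refine Finset.sum_congr rfl fun k _ => ?_
    congr 1
    exact (I.lam a).linearMap_vsub (p (b k)) (p i)
  have hlamb : ∀ k y, I.lam (b k) (ψ y) = y k := by
    intro k y
    rw [hlin, I.lam_apply_vertex hi, if_neg (hb k).2, add_zero, Finset.sum_eq_single k]
    · simp [I.lam_apply_vertex (hb k).1]
    · intro l _ hl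
      rw [I.lam_apply_vertex (hb l).1, if_neg (fun h => hl (hbinj h.symm))]
      simp
    · simp
  have hlami : ∀ y, I.lam i (ψ y) = 1 - ∑ k, y k := by
    intro y
    have h := hsum' (fun _ => (1 : ℝ)) (ψ y)
    simp only [smul_eq_mul, mul_one, I.sum_lam, hlamb] at h
    linarith
  have himage : ψ '' corner d = I.simplex := by
    ext x
    constructor
    · rintro ⟨y, hy, rfl⟩ a
      by_cases ha : a ∈ I.verts
      · by_cases hai : a = i
        · rw [hai, hlami]
          exact sub_nonneg.2 hy.2
        · obtain ⟨k, hk⟩ := e.surjective ⟨a, Finset.mem_erase.2 ⟨hai, ha⟩⟩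
          have hk' : b k = a := congrArg Subtype.val hk
          rw [← hk', hlamb]
          exact hy.1 k
      · simp [I.lam_of_notMem ha]
    · intro hx
      have h1 := hsum' (fun _ => (1 : ℝ)) x
      simp only [smul_eq_mul, mul_one, I.sum_lam] at h1
      refine ⟨fun k => I.lam (b k) x, ⟨fun k => hx (b k), ?_⟩, ?_⟩
      · have := hx i
        linarith
      · have h2 := hsum' p x
        rw [I.sum_lam_smul_self] at h2
        conv_rhs => rw [h2]
        simp only [ψ, hL, smul_sub, Finset.sum_sub_distrib, ← Finset.sum_smul]
        have h3 : I.lam i x = 1 - ∑ k, I.lam (b k) x := by linarith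
        rw [h3, sub_smul, one_smul]
        abel
  have hinj : Set.InjOn ψ (corner d) := by
    intro y _ y' _ h
    ext k
    rw [← hlamb k y, ← hlamb k y', h]
  have hder : ∀ x ∈ corner d, HasFDerivWithinAt ψ Lr (corner d) x := fun x _ =>
    (Lr.hasFDerivAt.add_const (p i)).hasFDerivWithinAt
  -- Pulled back along `ψ`, the coordinate of `i` becomes 1 minus the coordinate sum, whose integral
  -- over the corner is 1/(d+1)!. The change of variables contributes the absolute determinant.
  refine ⟨|Mz.det|, ?_⟩
  rw [← himage, integral_image_eq_integral_abs_det_fderiv_smul volume (measurableSet_corner d)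
    hder hinj]
  simp_rw [hlami, hdet, smul_eq_mul]
  rw [integral_const_mul, integral_corner]
  push_cast
  have : ((d + 1).factorial : ℝ) ≠ 0 := by positivity
  field_simp

end SimplexIntegral

/-! ### Generic triangulations and integrality of the section integrals -/

section Existence

open MeasureTheory

/-- Failing to be optimal is an open condition on the heights, so a small perturbation creates no
new optimal cells. Each coincidence to be avoided defines a proper hyperplane of heights, and these
are null, so generic heights are dense. -/
theorem exists_generic_heights {A E : Type*} [Fintype A] [NormedAddCommGroup E] [NormedSpace ℝ E]
    {p : A → E} (ω₀ : A → ℝ) :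
    ∃ ω : A → ℝ, (∀ I : Cell p, ∀ a ∉ I.verts, I.interp ω (p a) ≠ ω a) ∧
      ∀ I : Cell p, I.Optimal ω → I.Optimal ω₀ := by
  classical
  have hcont : ∀ (I : Cell p) (a : A), Continuous fun ω : A → ℝ => I.interp ω (p a) := by
    intro I a
    simp only [Cell.interp_apply]
    fun_prop
  have h1 : ∀ᶠ ω in nhds ω₀, ∀ I : Cell p, I.Optimal ω → I.Optimal ω₀ := by
    rw [Filter.eventually_all]
    intro I
    by_cases hI : I.Optimal ω₀
    · exact Filter.Eventually.of_forall fun _ _ => hI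
    · simp only [Cell.Optimal, not_forall, not_le] at hI
      obtain ⟨a, ha⟩ := hI
      filter_upwards [((continuous_apply a).tendsto ω₀).eventually_lt ((hcont I a).tendsto ω₀) ha]
        with ω hω hopt
      exact absurd (hopt a) (not_le.2 hω)
  have h2 : ∀ᵐ ω : A → ℝ, ∀ I : Cell p, ∀ a ∉ I.verts, I.interp ω (p a) ≠ ω a := by
    rw [ae_all_iff]
    intro I
    rw [ae_all_iff]
    intro a
    by_cases ha : a ∈ I.verts
    · simp [ha]
    let l : (A → ℝ) →ₗ[ℝ] ℝ := (∑ b, I.lam b (p a) • LinearMap.proj (R := ℝ) (φ := fun _ : A => ℝ) b) -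
      LinearMap.proj a
    have hl : ∀ ω, l ω = I.interp ω (p a) - ω a := by
      intro ω
      simp [l, Cell.interp_apply, mul_comm]
    -- Since `a` is not a vertex, its height does not enter the interpolation, and `l` takes the
    -- value -1 on the unit vector of `a`.
    have hne : LinearMap.ker l ≠ ⊤ := by
      intro h
      have h0 : l (Pi.single a 1) = 0 := by
        rw [← LinearMap.mem_ker, h]
        trivial
      rw [hl, Cell.interp_apply] at h0
      simp [Pi.single_apply, I.lam_of_notMem ha] at h0
    have h0 := Measure.addHaar_submodule volume _ hne
    filter_upwards [measure_eq_zero_iff_ae_notMem.1 h0] with ω hω _ heq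
    exact hω (by rw [SetLike.mem_coe, LinearMap.mem_ker, hl, heq, sub_self])
  obtain ⟨ω, hω2, hω1⟩ := (Measure.dense_of_ae h2).inter_nhds_nonempty h1
  exact ⟨ω, hω2, hω1⟩

/-- On the overlap each interpolation bounds the other from below, so they agree. A vertex `j` of
`J` outside `I` has positive slack by genericity, so its coordinate vanishes there and the overlap
lies in a hyperplane. -/
theorem Cell.measure_inter_eq_zero {A E : Type*} [Fintype A] [NormedAddCommGroup E]
    [NormedSpace ℝ E] [FiniteDimensional ℝ E] [MeasurableSpace E] [BorelSpace E] (μ : Measure E)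
    [μ.IsAddHaarMeasure] {p : A → E} {ω : A → ℝ}
    (hω : ∀ I : Cell p, ∀ a ∉ I.verts, I.interp ω (p a) ≠ ω a) {I J : Cell p} (hIJ : I ≠ J)
    (hI : I.Optimal ω) (hJ : J.Optimal ω) : μ (I.simplex ∩ J.simplex) = 0 := by
  classical
  obtain ⟨j, hjJ, hjI⟩ : ∃ j ∈ J.verts, j ∉ I.verts := by
    by_contra! hsub
    refine hIJ (Cell.verts_injective ?_)
    exact (Finset.eq_of_subset_of_card_le hsub (by rw [I.card_verts, J.card_verts])).symm
  have hval : ∀ (I J : Cell p) (v : E),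
      ∑ a, J.lam a v * (ω a - I.interp ω (p a)) = J.interp ω v - I.interp ω v := by
    intro I J v
    have h1 := affineMap_sum_smul (I.interp ω) (J.sum_lam v) p
    rw [J.sum_lam_smul_self] at h1
    simp only [mul_sub, Finset.sum_sub_distrib, h1, J.interp_apply ω v, smul_eq_mul, mul_comm]
  have hnn : ∀ {I J : Cell p}, I.Optimal ω → ∀ {v}, v ∈ J.simplex → ∀ a,
      0 ≤ J.lam a v * (ω a - I.interp ω (p a)) := fun hI _ hv a =>
    mul_nonneg (hv a) (sub_nonneg.2 (hI a))
  have hsub : I.simplex ∩ J.simplex ⊆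
      ((AffineSubspace.mk' (0 : ℝ) (⊥ : Submodule ℝ ℝ)).comap (J.lam j) : Set E) := by
    rintro v ⟨hvI, hvJ⟩
    have h1 := Finset.sum_nonneg fun a (_ : a ∈ Finset.univ) => hnn hI hvJ a
    have h2 := Finset.sum_nonneg fun a (_ : a ∈ Finset.univ) => hnn hJ hvI a
    rw [hval] at h1 h2
    have h3 : ∑ a, J.lam a v * (ω a - I.interp ω (p a)) = 0 := by rw [hval]; linarith
    have h4 := (Finset.sum_eq_zero_iff_of_nonneg fun a _ => hnn hI hvJ a).1 h3 j
      (Finset.mem_univ _)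
    have h5 : J.lam j v = 0 :=
      (mul_eq_zero.1 h4).resolve_right (sub_ne_zero.2 (hω I j hjI).symm)
    simp [h5]
  refine measure_mono_null hsub (Measure.addHaar_affineSubspace μ _ fun htop => ?_)
  have h1 : p j ∈ (AffineSubspace.mk' (0 : ℝ) (⊥ : Submodule ℝ ℝ)).comap (J.lam j) := by
    rw [htop]
    trivial
  simp [J.lam_apply_vertex hjJ] at h1

variable {A M : Type*} [Fintype A] [NormedAddCommGroup M] [NormedSpace ℝ M]
  {d : ℕ} {pt : A → M} {π : M →ₗ[ℝ] (Fin d → ℝ)}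

theorem Cell.isCompact_simplex (I : Cell fun a => π (pt a)) : IsCompact I.simplex :=
  (isCompact_convexHull_range _).of_isClosed_subset I.isClosed_simplex I.simplex_subset

theorem Cell.factorial_smul_integral_lift_mem [FiniteDimensional ℝ M] {L : AddSubgroup M} (hL : ∀ a, pt a ∈ L)
    (hπ : ∀ a, π (pt a) ∈ intLattice d) (I : Cell fun a => π (pt a)) :
    ((d + 1).factorial : ℝ) • ∫ x in I.simplex, I.lift x ∈ L := by
  have h1 : ∫ x in I.simplex, I.lift x = ∑ a, (∫ x in I.simplex, I.lam a x) • pt a := by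
    simp only [Cell.lift]
    rw [integral_finsetSum]
    · simp only [integral_smul_const]
    · intro a _
      exact ((I.lam_continuous a).smul continuous_const).continuousOn.integrableOn_compact
        I.isCompact_simplex
  rw [h1, Finset.smul_sum]
  refine L.sum_mem fun a _ => ?_
  obtain ⟨k, hk⟩ := I.exists_integral_lam hπ a
  rw [smul_smul, hk, Int.cast_smul_eq_zsmul]
  exact L.zsmul_mem (hL a) k

/-- The integrals of the sections, multiplied by `(d+1)!`. -/
def sectionIntegrals (pt : A → M) (π : M →ₗ[ℝ] (Fin d → ℝ)) : Set M :=
  {w | ∃ γ, IsFiberSection pt π volume γ ∧ w = ((d + 1).factorial : ℝ) •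
    ∫ x in convexHull ℝ (Set.range fun a => π (pt a)), γ x}

theorem convex_sectionIntegrals : Convex ℝ (sectionIntegrals pt π) := by
  rintro _ ⟨γ, hγ, rfl⟩ _ ⟨γ', hγ', rfl⟩ s t hs ht hst
  refine ⟨fun x => s • γ x + t • γ' x, ⟨(hγ.1.smul s).add (hγ'.1.smul t), ?_, ?_⟩, ?_⟩
  · intro x hx
    exact convex_convexHull ℝ _ (hγ.mem x hx) (hγ'.mem x hx) hs ht hst
  · intro x hx
    rw [map_add, map_smul, map_smul, hγ.map x hx, hγ'.map x hx, ← add_smul, hst, one_smul]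
  · rw [integral_add (f := fun x => s • γ x) (g := fun x => t • γ' x) (hγ.1.smul s)
      (hγ'.1.smul t), integral_smul, integral_smul, smul_add, smul_comm s, smul_comm t]

variable [FiniteDimensional ℝ M]

/-- Every linear functional attains its minimum over the section integrals at the lattice point
given by a set of cells. -/
theorem exists_minimal_sectionIntegral
    (hp : (interior (convexHull ℝ (Set.range fun a => π (pt a)))).Nonempty) (f : M →ₗ[ℝ] ℝ) :
    ∃ T : Finset (Cell fun a => π (pt a)),
      (∑ I ∈ T, ((d + 1).factorial : ℝ) • ∫ x in I.simplex, I.lift x) ∈ sectionIntegrals pt π ∧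
      ∀ w ∈ sectionIntegrals pt π,
        f (∑ I ∈ T, ((d + 1).factorial : ℝ) • ∫ x in I.simplex, I.lift x) ≤ f w := by
  classical
  borelize M
  -- The cells optimal for `ω` are still optimal for `f`, but now overlap in null sets. Hence the
  -- integral of the selected section depends only on the set `T` of cells.
  obtain ⟨ω, hω, hopt⟩ := exists_generic_heights (p := fun a => π (pt a)) fun a => f (pt a)
  let T := Finset.univ.filter fun I : Cell fun a => π (pt a) => I.Optimal ω
  have hT : ∀ {I}, I ∈ T ↔ I.Optimal ω := fun {I} => by simp [T]
  obtain ⟨γ, hγ, h⟩ := exists_measurable_selection T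
  set D := convexHull ℝ (Set.range fun a => π (pt a)) with hD
  have hmin : ∀ x ∈ D, ∃ I ∈ T, x ∈ I.simplex ∧ γ x = I.lift x := by
    intro x hx
    obtain ⟨I, hI, hxI⟩ := exists_optimal_cell hp ω hx
    exact h x ⟨I, hT.2 hI, hxI⟩
  have hsec : IsFiberSection pt π volume γ := by
    refine isFiberSection_of_measurable volume hγ ?_ ?_ <;>
    · intro x hx
      obtain ⟨I, -, hxI, he⟩ := hmin x hx
      simp only [he, I.lift_mem hxI, I.map_lift]
  have hU : D = ⋃ I : T, I.1.simplex := by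
    apply Set.Subset.antisymm
    · intro x hx
      obtain ⟨I, hI, hxI, -⟩ := hmin x hx
      exact Set.mem_iUnion.2 ⟨⟨I, hI⟩, hxI⟩
    · exact Set.iUnion_subset fun I => I.1.simplex_subset
  have hdisj : Pairwise fun I J : T => AEDisjoint volume I.1.simplex J.1.simplex :=
    fun I J hIJ => Cell.measure_inter_eq_zero volume hω
      (fun h => hIJ (Subtype.ext h)) (hT.1 I.2) (hT.1 J.2)
  have hint : ∫ x in D, γ x = ∑ I ∈ T, ∫ x in I.simplex, I.lift x := by
    have h1 := integral_iUnion_ae (μ := volume) (f := γ) (s := fun I : T => I.1.simplex)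
      (fun I => I.1.isClosed_simplex.measurableSet.nullMeasurableSet) hdisj
      (by rw [← hU]; exact hsec.1)
    rw [← hU, tsum_fintype] at h1
    rw [h1, ← Finset.sum_coe_sort T]
    refine Finset.sum_congr rfl fun I _ => ?_
    refine setIntegral_congr_ae I.1.isClosed_simplex.measurableSet ?_
    -- The selection may use any cell through `x`; off the overlaps that cell can only be `I`.
    have hnull : ∀ᵐ x, ∀ J : T, J ≠ I → x ∉ I.1.simplex ∩ J.1.simplex := by
      rw [ae_all_iff]
      intro J
      by_cases hJ : J = I
      · simp [hJ]
      · filter_upwards [measure_eq_zero_iff_ae_notMem.1 (hdisj (Ne.symm hJ))] with x hx _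
        exact hx
    filter_upwards [hnull] with x hx hxI
    obtain ⟨J, hJ, hxJ, he⟩ := h x ⟨I, I.2, hxI⟩
    by_cases hJI : (⟨J, hJ⟩ : T) = I
    · rw [he, ← hJI]
    · exact absurd ⟨hxI, hxJ⟩ (hx ⟨J, hJ⟩ hJI)
  have hw : ∑ I ∈ T, ((d + 1).factorial : ℝ) • ∫ x in I.simplex, I.lift x =
      ((d + 1).factorial : ℝ) • ∫ x in D, γ x := by
    rw [hint, Finset.smul_sum]
  refine ⟨T, ⟨γ, hsec, hw⟩, ?_⟩
  rintro _ ⟨γ', hγ', rfl⟩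
  rw [hw, map_smul, map_smul, smul_eq_mul, smul_eq_mul]
  refine mul_le_mul_of_nonneg_left (hsec.le_of_ae hγ' ?_) (by positivity)
  filter_upwards [ae_restrict_mem (isCompact_convexHull_range _).measurableSet] with x hx
  obtain ⟨I, hI, hxI, he⟩ := hmin x hx
  rw [he]
  exact (hopt I (hT.1 hI)).lift_mem_fiberMin hxI

/-- The section integrals, multiplied by `(d+1)!`, form a lattice polytope. -/
theorem isLatticePolytope_sectionIntegrals
    (hp : (interior (convexHull ℝ (Set.range fun a => π (pt a)))).Nonempty) {L : AddSubgroup M}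
    (hL : ∀ a, pt a ∈ L) (hπ : ∀ a, π (pt a) ∈ intLattice d) :
    IsLatticePolytope L (sectionIntegrals pt π) := by
  classical
  let F : Finset (Cell fun a => π (pt a)) → M := fun T =>
    ∑ I ∈ T, ((d + 1).factorial : ℝ) • ∫ x in I.simplex, I.lift x
  have hfin : (Set.range F ∩ sectionIntegrals pt π).Finite := (Set.finite_range F).inter_of_left _
  have hV : ((hfin.toFinset : Finset M) : Set M) = Set.range F ∩ sectionIntegrals pt π :=
    hfin.coe_toFinset
  refine ⟨hfin.toFinset, ?_, ?_, ?_⟩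
  · obtain ⟨T, hT, -⟩ := exists_minimal_sectionIntegral hp (0 : M →ₗ[ℝ] ℝ)
    exact ⟨F T, hfin.mem_toFinset.2 ⟨⟨T, rfl⟩, hT⟩⟩
  · rw [hV]
    rintro _ ⟨⟨T, rfl⟩, -⟩
    exact L.sum_mem fun I _ => I.factorial_smul_integral_lift_mem hL hπ
  · rw [hV]
    apply Set.Subset.antisymm
    · intro x hx
      by_contra hcon
      -- A section integral outside the hull would be separated from it by some `f`, whose minimum
      -- is nevertheless attained at one of the finitely many candidates.
      obtain ⟨f, s, hfx, hfs⟩ := geometric_hahn_banach_point_closed (convex_convexHull ℝ _)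
        (hfin.isClosed_convexHull ℝ) hcon
      obtain ⟨T, hT, hmin⟩ := exists_minimal_sectionIntegral hp f.toLinearMap
      have h1 := hfs (F T) (subset_convexHull ℝ _ ⟨⟨T, rfl⟩, hT⟩)
      have h2 : f (F T) ≤ f x := hmin x hx
      linarith
    · exact convexHull_min Set.inter_subset_right convex_sectionIntegrals

end Existence

/-! ### Operations on polytopes, their fibers and support functions -/

section LatticePolytopes

variable {M M' : Type*} [AddCommGroup M] [Module ℝ M] [AddCommGroup M'] [Module ℝ M']
  {L : AddSubgroup M}

theorem IsLatticePolytope.nonempty {K : Set M} (h : IsLatticePolytope L K) : K.Nonempty := by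
  obtain ⟨S, hS, -, rfl⟩ := h
  exact (Finset.coe_nonempty.2 hS).convexHull

theorem IsLatticePolytope.mono {L' : AddSubgroup M} (hL : L ≤ L') {K : Set M}
    (h : IsLatticePolytope L K) : IsLatticePolytope L' K := by
  obtain ⟨S, hS, hSL, rfl⟩ := h
  exact ⟨S, hS, hSL.trans hL, rfl⟩

theorem IsLatticePolytope.add {K K' : Set M} (h : IsLatticePolytope L K)
    (h' : IsLatticePolytope L K') : IsLatticePolytope L (K + K') := by
  classical
  obtain ⟨S, hS, hSL, rfl⟩ := h
  obtain ⟨S', hS', hSL', rfl⟩ := h'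
  refine ⟨S + S', hS.add hS', ?_, ?_⟩
  · rw [Finset.coe_add]
    rintro _ ⟨x, hx, y, hy, rfl⟩
    exact L.add_mem (hSL hx) (hSL' hy)
  · rw [Finset.coe_add, convexHull_add]

theorem IsLatticePolytope.image {K : Set M} (h : IsLatticePolytope L K) {L' : AddSubgroup M'}
    (f : M →ₗ[ℝ] M') (hf : ∀ x ∈ L, f x ∈ L') : IsLatticePolytope L' (f '' K) := by
  classical
  obtain ⟨S, hS, hSL, rfl⟩ := h
  refine ⟨S.image f, hS.image f, ?_, ?_⟩
  · rw [Finset.coe_image]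
    rintro _ ⟨x, hx, rfl⟩
    exact hf x (hSL hx)
  · rw [Finset.coe_image, LinearMap.image_convexHull]

theorem isLatticePolytope_singleton {x : M} (hx : x ∈ L) : IsLatticePolytope L {x} :=
  ⟨{x}, Finset.singleton_nonempty x, by simpa using hx, by simp⟩

theorem IsLatticePolytope.translate {K : Set M} (h : IsLatticePolytope L K) {t : M}
    (ht : t ∈ L) : IsLatticePolytope L ((fun x => t + x) '' K) := by
  have := (isLatticePolytope_singleton ht).add h
  rwa [Set.singleton_add] at this

theorem IsLatticePolytope.convex {K : Set M} (h : IsLatticePolytope L K) : Convex ℝ K := by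
  obtain ⟨S, -, -, rfl⟩ := h
  exact convex_convexHull ℝ _

theorem IsLatticePolytope.isCompact {V : Type*} [NormedAddCommGroup V] [NormedSpace ℝ V]
    {L : AddSubgroup V} {K : Set V} (h : IsLatticePolytope L K) : IsCompact K := by
  obtain ⟨S, -, -, rfl⟩ := h
  exact S.finite_toSet.isCompact_convexHull ℝ

/-- A fiber of a linear map on a polytope is a polytope. -/
theorem isLatticePolytope_top_fiber {A : Type*} [Fintype A] (pt : A → M) (π : M →ₗ[ℝ] M')
    {v : M'} (hne : {x | x ∈ convexHull ℝ (Set.range pt) ∧ π x = v}.Nonempty) :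
    IsLatticePolytope ⊤ {x | x ∈ convexHull ℝ (Set.range pt) ∧ π x = v} := by
  classical
  let l : (A → ℝ) →ₗ[ℝ] M := Fintype.linearCombination ℝ pt
  have himage : l '' stdSimplex ℝ A = convexHull ℝ (Set.range pt) := by
    rw [← convexHull_rangle_single_eq_stdSimplex, LinearMap.image_convexHull, ← Set.range_comp]
    congr 2
    ext a
    simp [l, Fintype.linearCombination_apply, Pi.single_apply]
  -- The fiber is the image under `l` of this affine slice of the standard simplex, so it suffices
  -- that the slice has finitely many extreme points.
  let X : Set (A → ℝ) := {y | y ∈ stdSimplex ℝ A ∧ π (l y) = v}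
  have hlX : l '' X = {x | x ∈ convexHull ℝ (Set.range pt) ∧ π x = v} := by
    rw [← himage]
    ext x
    constructor
    · rintro ⟨y, ⟨hy, hv⟩, rfl⟩
      exact ⟨⟨y, hy, rfl⟩, hv⟩
    · rintro ⟨⟨y, hy, rfl⟩, hv⟩
      exact ⟨y, ⟨hy, hv⟩, rfl⟩
  have hXconv : Convex ℝ X := by
    refine (convex_stdSimplex ℝ A).inter (t := {y | π (l y) = v}) ?_
    intro y hy y' hy' s t _ _ hst
    simp only [Set.mem_ofPred_eq] at hy hy' ⊢
    rw [map_add, map_smul, map_smul, map_add, map_smul, map_smul, hy, hy', ← add_smul, hst,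
      one_smul]
  have hXcomp : IsCompact X := by
    obtain ⟨_, hx⟩ := hlX ▸ hne
    obtain ⟨y₀, ⟨hy₀, hv₀⟩, -⟩ := hx
    have heq : X = stdSimplex ℝ A ∩
        (fun y => y - y₀) ⁻¹' (LinearMap.ker (π ∘ₗ l) : Set (A → ℝ)) := by
      ext y
      simp [X, hv₀, sub_eq_zero]
    rw [heq]
    exact (isCompact_stdSimplex ℝ A).inter_right
      ((Submodule.closed_of_finiteDimensional _).preimage (by fun_prop))
  have hfin : (X.extremePoints ℝ).Finite := by
    refine Set.Finite.of_finite_image (f := fun y : A → ℝ => Finset.univ.filter fun a => y a ≠ 0)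
      (Set.toFinite _) ?_
    intro y hy y' hy' hsupp
    have hsub : ∀ a, y' a = 0 → y a = 0 := by
      intro a ha
      by_contra hne
      have : a ∈ Finset.univ.filter fun a => y a ≠ 0 := by simpa using hne
      have : a ∈ Finset.univ.filter fun a => y' a ≠ 0 := by
        rw [← show (Finset.univ.filter fun a => y a ≠ 0) =
          Finset.univ.filter fun a => y' a ≠ 0 from hsupp]
        exact this
      exact (Finset.mem_filter.1 this).2 ha
    have hyX := hy.1
    have hyX' := hy'.1
    obtain ⟨ε, hε, hεle⟩ := exists_pos_forall_mul_abs_le Finset.univ (fun a => y' a)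
      (fun a => y a - y' a) (fun a _ => hyX'.1.1 a) (fun a _ ha => by simp [ha, hsub a ha])
    -- An extreme point is determined by its support: if `y` vanishes wherever `y'` does, the
    -- segment from `y` to `y'` can be prolonged past `y'` inside `X`, so extremality of `y'` forces
    -- `y = y'`.
    let z : A → ℝ := y' - ε • (y - y')
    have hz : z ∈ X := by
      refine ⟨⟨fun a => ?_, ?_⟩, ?_⟩
      · have h1 := hεle a (Finset.mem_univ a)
        have h2 := mul_le_mul_of_nonneg_left (le_abs_self (y a - y' a)) hε.le
        simp only [z, Pi.sub_apply, Pi.smul_apply, smul_eq_mul]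
        linarith
      · simp [z, Finset.sum_sub_distrib, ← Finset.mul_sum, hyX.1.2, hyX'.1.2]
      · simp [z, hyX.2, hyX'.2]
    have hpos : 0 < 1 + ε := by linarith
    refine (mem_extremePoints.1 hy').2 y hyX z hz ⟨ε / (1 + ε), 1 / (1 + ε), by positivity,
      by positivity, by field_simp; ring, ?_⟩ |>.1
    ext a
    simp only [z, Pi.add_apply, Pi.smul_apply, Pi.sub_apply, smul_eq_mul]
    field_simp
    ring
  have hXeq : X = convexHull ℝ (X.extremePoints ℝ) := by
    rw [← (hfin.isClosed_convexHull ℝ).closure_eq]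
    exact (closure_convexHull_extremePoints hXcomp hXconv).symm
  refine ⟨hfin.toFinset.image l, ?_, fun _ _ => trivial, ?_⟩
  · rw [Finset.image_nonempty, Set.Finite.toFinset_nonempty,
      ← convexHull_nonempty_iff (𝕜 := ℝ), ← hXeq]
    exact Set.image_nonempty.1 (hlX ▸ hne)
  · rw [Finset.coe_image, Set.Finite.coe_toFinset, ← LinearMap.image_convexHull, ← hXeq, hlX]

theorem normallyEquivalent_of_normalFan_eq' {V N : Type*} [NormedAddCommGroup V]
    [NormedSpace ℝ V] [FiniteDimensional ℝ V] [AddCommGroup N] [Module ℝ N]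
    (B : V →ₗ[ℝ] N →ₗ[ℝ] ℝ) (hB : ∀ l : V →ₗ[ℝ] ℝ, ∃ w, ∀ u, B u w = l u)
    {L L' : AddSubgroup V} {K K' : Set V} (hK : IsLatticePolytope L K)
    (hK' : IsLatticePolytope L' K') (h : normalFan B K = normalFan B K') :
    NormallyEquivalent B K K' := by
  obtain ⟨S, hS, -, rfl⟩ := hK
  obtain ⟨S', hS', -, rfl⟩ := hK'
  exact normallyEquivalent_of_normalFan_eq B hB hS hS' h

/-- Polytopes have the same normal fan if each vector refines in the same way. -/
theorem normalFan_eq_of_forall {N : Type*} [AddCommGroup N] [Module ℝ N]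
    (B : M →ₗ[ℝ] N →ₗ[ℝ] ℝ) {L L' : AddSubgroup M} {K K' : Set M} (hK : IsLatticePolytope L K)
    (hK' : IsLatticePolytope L' K')
    (h : ∀ w w', (∀ u ∈ K, w ∈ normalCone B K u → w' ∈ normalCone B K u) ↔
      (∀ u ∈ K', w ∈ normalCone B K' u → w' ∈ normalCone B K' u)) :
    normalFan B K = normalFan B K' := by
  obtain ⟨S, hS, -, rfl⟩ := hK
  obtain ⟨S', hS', -, rfl⟩ := hK'
  rw [← commonRefinement_normalFan B hS, ← commonRefinement_normalFan B hS']
  unfold commonRefinement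
  congr 1
  ext w w'
  rw [mem_sInter_normalFan, mem_sInter_normalFan]
  exact h w _

/-- A polytope is recovered from its support function. -/
theorem polytopeOfSupportFunction_supportFunction {V N : Type*} [NormedAddCommGroup V]
    [NormedSpace ℝ V] [AddCommGroup N] [Module ℝ N] [FiniteDimensional ℝ V]
    (B : V →ₗ[ℝ] N →ₗ[ℝ] ℝ) (hB : ∀ l : V →ₗ[ℝ] ℝ, ∃ w, ∀ u, B u w = l u)
    {L : AddSubgroup V} {K : Set V} (hK : IsLatticePolytope L K) :
    polytopeOfSupportFunction B (supportFunction B K) = K := by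
  have hbdd : ∀ w, BddBelow ((fun u => B u w) '' K) := fun w =>
    (hK.isCompact.image (LinearMap.continuous_of_finiteDimensional (B.flip w))).bddBelow
  apply Set.Subset.antisymm
  · intro u hu
    by_contra hcon
    obtain ⟨f, s, hfu, hfs⟩ := geometric_hahn_banach_point_closed hK.convex
      hK.isCompact.isClosed hcon
    obtain ⟨w, hw⟩ := hB f.toLinearMap
    have h1 : supportFunction B K w ≤ B u w := hu w
    have h2 : s ≤ supportFunction B K w := by
      refine le_csInf (hK.nonempty.image _) ?_
      rintro _ ⟨x, hx, rfl⟩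
      simp only [hw]
      exact (hfs x hx).le
    rw [hw] at h1
    have h3 : f u < s := hfu
    have h4 : supportFunction B K w ≤ f u := h1
    linarith
  · intro u hu w
    exact csInf_le (hbdd w) ⟨u, hu, rfl⟩

theorem normalCone_homothety {N : Type*} [AddCommGroup N] [Module ℝ N] (B : M →ₗ[ℝ] N →ₗ[ℝ] ℝ)
    (K : Set M) (t : M) {c : ℝ} (hc : 0 < c) (u : M) :
    normalCone B ((fun x => t + c • x) '' K) (t + c • u) = normalCone B K u := by
  ext w
  constructor
  · intro h u' hu'
    have := h (t + c • u') ⟨u', hu', rfl⟩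
    simp only [map_add, map_smul, LinearMap.add_apply, LinearMap.smul_apply, smul_eq_mul] at this
    exact le_of_mul_le_mul_left (by linarith) hc
  · rintro h _ ⟨u', hu', rfl⟩
    have := mul_le_mul_of_nonneg_left (h u' hu') hc.le
    simp only [map_add, map_smul, LinearMap.add_apply, LinearMap.smul_apply, smul_eq_mul]
    linarith

end LatticePolytopes

/-! ### The diagonal, the quotient fan and the fiber polytope in coordinates -/

section Coordinates

variable {d m : ℕ}

theorem pairing_apply (u v : Fin d → ℝ) : pairing d u v = ∑ j, u j * v j := rfl

theorem pairingPow_apply (u v : Fin m → Fin d → ℝ) :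
    pairingPow d m u v = ∑ i, pairing d (u i) (v i) := rfl

theorem diagStar_apply (u : Fin m → Fin d → ℝ) : diagStar d m u = ∑ i, u i := by
  simp [diagStar]

theorem exists_pairing_eq (l : (Fin d → ℝ) →ₗ[ℝ] ℝ) : ∃ w, ∀ u, pairing d u w = l u := by
  refine ⟨fun j => l (Pi.single j 1), fun u => ?_⟩
  conv_rhs => rw [pi_eq_sum_univ' u]
  simp [pairing_apply, map_sum]

theorem exists_pairingPow_eq (l : (Fin m → Fin d → ℝ) →ₗ[ℝ] ℝ) :
    ∃ w, ∀ u, pairingPow d m u w = l u := by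
  choose w hw using fun i => exists_pairing_eq (l ∘ₗ LinearMap.single ℝ (fun _ => Fin d → ℝ) i)
  refine ⟨w, fun u => ?_⟩
  conv_rhs => rw [← Finset.univ_sum_single u, map_sum]
  rw [pairingPow_apply]
  exact Finset.sum_congr rfl fun i _ => hw i (u i)

theorem mem_intLatticePow_iff {u : Fin m → Fin d → ℝ} :
    u ∈ intLatticePow d m ↔ ∀ i, u i ∈ intLattice d := by
  constructor
  · rintro ⟨n, rfl⟩ i
    exact ⟨n i, rfl⟩
  · intro h
    choose n hn using h
    exact ⟨n, funext hn⟩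

theorem diagStar_mem_intLattice {u : Fin m → Fin d → ℝ} (hu : u ∈ intLatticePow d m) :
    diagStar d m u ∈ intLattice d := by
  rw [diagStar_apply]
  exact (intLattice d).sum_mem fun i _ => mem_intLatticePow_iff.1 hu i

theorem map_diagStar_intLatticePow (hm : 1 ≤ m) :
    (intLatticePow d m).map (diagStar d m).toAddMonoidHom = intLattice d := by
  classical
  apply le_antisymm
  · rintro _ ⟨u, hu, rfl⟩
    exact diagStar_mem_intLattice hu
  · intro x hx
    refine ⟨Pi.single ⟨0, hm⟩ x, mem_intLatticePow_iff.2 fun i => ?_, ?_⟩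
    · by_cases hi : i = ⟨0, hm⟩
      · subst hi
        simpa using hx
      · simp [Pi.single_eq_of_ne hi, (intLattice d).zero_mem]
    · change diagStar d m _ = x
      rw [diagStar_apply]
      simp

theorem diagStar_quotStar (y : Module.Dual ℝ (DiagQuot d m)) :
    diagStar d m (quotStar d m y) = 0 := by
  have h : ∀ v, pairing d (diagStar d m (quotStar d m y)) v = 0 := by
    intro v
    rw [pairing_diagStar, pairingPow_quotStar]
    have : quot d m (diag d m v) = 0 :=
      (Submodule.Quotient.mk_eq_zero _).2 (LinearMap.mem_range_self _ v)
    rw [this, map_zero]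
  ext j
  simpa [pairing_apply, Pi.single_apply] using h (Pi.single j 1)

/-- Together with `diagStar_quotStar` this is exactness of the dual sequence: pairing with `u` kills
the diagonal, hence descends to the quotient. -/
theorem exists_quotStar_eq {u : Fin m → Fin d → ℝ} (hu : diagStar d m u = 0) :
    ∃ y, quotStar d m y = u := by
  refine ⟨(LinearMap.range (diag d m)).liftQ (pairingPow d m u) ?_, ?_⟩
  · rintro _ ⟨v, rfl⟩
    rw [LinearMap.mem_ker, ← pairing_diagStar, hu, map_zero, LinearMap.zero_apply]
  · ext i j
    change pairingPow d m u (Pi.single i (Pi.single j 1)) = u i j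
    rw [pairingPow_apply, Finset.sum_eq_single i]
    · simp [pairing_apply, Pi.single_apply]
    · intro k _ hk
      simp [Pi.single_eq_of_ne hk]
    · simp

theorem quot_surjective : Function.Surjective (quot d m) := Submodule.mkQ_surjective _

theorem quot_eq_iff {w w' : Fin m → Fin d → ℝ} :
    quot d m w = quot d m w' ↔ ∃ h, w = w' + diag d m h := by
  have : quot d m w = quot d m w' ↔ w - w' ∈ LinearMap.range (diag d m) :=
    Submodule.Quotient.eq _
  rw [this]
  constructor
  · rintro ⟨h, hh⟩
    exact ⟨h, by rw [hh]; abel⟩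
  · rintro ⟨h, rfl⟩
    exact ⟨h, by abel⟩

variable {P : Set (Fin d → ℝ)}

theorem normalCone_polyPow {u : Fin m → Fin d → ℝ} (hu : u ∈ polyPow P m) :
    normalCone (pairingPow d m) (polyPow P m) u =
      Set.univ.pi fun i => normalCone (pairing d) P (u i) := by
  classical
  ext w
  constructor
  · intro h i _ x hx
    have h1 := h (Function.update u i x) (fun k _ => by
      by_cases hk : k = i
      · subst hk
        simpa using hx
      · simpa [hk] using hu k trivial)
    rw [pairingPow_apply, pairingPow_apply, ← Finset.add_sum_erase _ _ (Finset.mem_univ i),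
      ← Finset.add_sum_erase _ _ (Finset.mem_univ i), Function.update_self] at h1
    have h2 : ∑ k ∈ Finset.univ.erase i, pairing d (Function.update u i x k) (w k) =
        ∑ k ∈ Finset.univ.erase i, pairing d (u k) (w k) :=
      Finset.sum_congr rfl fun k hk => by
        rw [Function.update_of_ne (Finset.ne_of_mem_erase hk)]
    rw [h2] at h1
    linarith
  · intro h u' hu'
    rw [pairingPow_apply, pairingPow_apply]
    exact Finset.sum_le_sum fun i _ => h i trivial _ (hu' i trivial)

theorem fanPow_eq : fanPow P m = normalFan (pairingPow d m) (polyPow P m) := by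
  ext τ
  constructor
  · rintro ⟨σ, hσ, rfl⟩
    choose u hu hσ using hσ
    have hu' : u ∈ polyPow P m := fun i _ => hu i
    refine ⟨u, hu', ?_⟩
    rw [normalCone_polyPow hu']
    simp only [hσ]
  · rintro ⟨u, hu, rfl⟩
    exact ⟨fun i => normalCone (pairing d) P (u i), fun i => ⟨u i, hu i trivial, rfl⟩,
      normalCone_polyPow hu⟩

theorem diagStar_image_polyPow (hP : Convex ℝ P) (hm : 1 ≤ m) :
    diagStar d m '' polyPow P m = (m : ℝ) • P := by
  have hm0 : (m : ℝ) ≠ 0 := by positivity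
  ext x
  constructor
  · rintro ⟨u, hu, rfl⟩
    refine ⟨∑ i : Fin m, (m : ℝ)⁻¹ • u i, hP.sum_mem (fun _ _ => by positivity) (by simp [hm0])
      (fun i _ => hu i trivial), ?_⟩
    simp only [← Finset.smul_sum, diagStar_apply]
    rw [smul_smul, mul_inv_cancel₀ hm0, one_smul]
  · rintro ⟨y, hy, rfl⟩
    exact ⟨fun _ => y, fun _ _ => hy, by simp [diagStar_apply, Nat.cast_smul_eq_nsmul]⟩

/-- The vertices of the power of a polytope. -/
def powPoint (S : Finset (Fin d → ℝ)) (m : ℕ) (a : Fin m → S) : Fin m → Fin d → ℝ :=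
  fun i => a i

theorem polyPow_eq_convexHull (S : Finset (Fin d → ℝ)) :
    polyPow (convexHull ℝ (S : Set (Fin d → ℝ))) m = convexHull ℝ (Set.range (powPoint S m)) := by
  have : Set.range (powPoint S m) = Set.univ.pi fun _ => (S : Set (Fin d → ℝ)) := by
    ext u
    constructor
    · rintro ⟨a, rfl⟩ i _
      exact (a i).2
    · intro hu
      exact ⟨fun i => ⟨u i, hu i trivial⟩, rfl⟩
  rw [this, convexHull_pi]
  rfl

theorem smul_eq_convexHull (S : Finset (Fin d → ℝ)) (hm : 1 ≤ m) :
    (m : ℝ) • convexHull ℝ (S : Set (Fin d → ℝ)) =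
      convexHull ℝ (Set.range fun a => diagStar d m (powPoint S m a)) := by
  rw [← diagStar_image_polyPow (convex_convexHull ℝ _) hm, polyPow_eq_convexHull,
    LinearMap.image_convexHull, ← Set.range_comp]
  rfl

theorem interior_smul_nonempty (S : Finset (Fin d → ℝ)) (hm : 1 ≤ m)
    (hfull : affineSpan ℝ (convexHull ℝ (S : Set (Fin d → ℝ))) = ⊤) :
    (interior (convexHull ℝ (Set.range fun a => diagStar d m (powPoint S m a)))).Nonempty := by
  have hm0 : (m : ℝ) ≠ 0 := by positivity
  rw [← smul_eq_convexHull S hm, interior_smul₀ hm0]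
  exact ((convex_convexHull ℝ _).interior_nonempty_iff_affineSpan_eq_top.2 hfull).smul_set

/-- The functional on `(ℝ^d)^m` given by pairing with `w`. -/
noncomputable abbrev pairFun (w : Fin m → Fin d → ℝ) : (Fin m → Fin d → ℝ) →ₗ[ℝ] ℝ :=
  (pairingPow d m).flip w

/-- Changing `w` within its class adds some δ(h), and pairing with δ(h) is `h` composed with δ*. So
a representative normal at `u` is exactly the dual certificate of `mem_fiberMin_iff`. -/
theorem quot_mem_image_normalCone_iff {S : Finset (Fin d → ℝ)} (hm : 1 ≤ m)
    (hfull : affineSpan ℝ (convexHull ℝ (S : Set (Fin d → ℝ))) = ⊤) {u : Fin m → Fin d → ℝ}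
    (hu : u ∈ polyPow (convexHull ℝ (S : Set (Fin d → ℝ))) m) (w : Fin m → Fin d → ℝ) :
    quot d m w ∈ quot d m ''
        normalCone (pairingPow d m) (polyPow (convexHull ℝ (S : Set (Fin d → ℝ))) m) u ↔
      u ∈ fiberMin (powPoint S m) (diagStar d m) (pairFun w) := by
  rw [mem_fiberMin_iff (interior_smul_nonempty S hm hfull), ← polyPow_eq_convexHull]
  constructor
  · rintro ⟨w', hw', hq⟩
    obtain ⟨h, rfl⟩ := quot_eq_iff.1 hq
    refine ⟨hu, (pairing d).flip h, fun u' hu' => ?_⟩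
    have := hw' u' hu'
    simpa [pairing_diagStar] using this
  · rintro ⟨-, l, hl⟩
    obtain ⟨h, hh⟩ := exists_pairing_eq l
    refine ⟨w + diag d m h, fun u' hu' => ?_, ?_⟩
    · have := hl u' hu'
      simpa [← hh, pairing_diagStar] using this
    · rw [quot_eq_iff]
      exact ⟨h, rfl⟩

theorem mem_sInter_quotientFan_iff {S : Finset (Fin d → ℝ)} (hm : 1 ≤ m)
    (hfull : affineSpan ℝ (convexHull ℝ (S : Set (Fin d → ℝ))) = ⊤) (w w' : Fin m → Fin d → ℝ) :
    quot d m w' ∈ ⋂₀ {σ | σ ∈ (fun τ => quot d m '' τ) ''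
        fanPow (convexHull ℝ (S : Set (Fin d → ℝ))) m ∧ quot d m w ∈ σ} ↔
      fiberMin (powPoint S m) (diagStar d m) (pairFun w) ⊆
        fiberMin (powPoint S m) (diagStar d m) (pairFun w') := by
  rw [fanPow_eq]
  constructor
  · intro h u hu
    have huP : u ∈ polyPow (convexHull ℝ (S : Set (Fin d → ℝ))) m := by
      rw [polyPow_eq_convexHull]
      exact hu.1
    rw [← quot_mem_image_normalCone_iff hm hfull huP] at hu ⊢
    exact h _ ⟨⟨_, ⟨u, huP, rfl⟩, rfl⟩, hu⟩
  · rintro h _ ⟨⟨_, ⟨u, huP, rfl⟩, rfl⟩, hw⟩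
    simp only at hw ⊢
    rw [quot_mem_image_normalCone_iff hm hfull huP] at hw ⊢
    exact h hw

open MeasureTheory

theorem chowScale_pos {S : Finset (Fin d → ℝ)} (hm : 1 ≤ m)
    (hfull : affineSpan ℝ (convexHull ℝ (S : Set (Fin d → ℝ))) = ⊤) :
    0 < chowScale (convexHull ℝ (S : Set (Fin d → ℝ))) m := by
  unfold chowScale
  rw [smul_eq_convexHull S hm]
  have hc := isCompact_convexHull_range fun a => diagStar d m (powPoint S m a)
  have : 0 < volume.real (convexHull ℝ (Set.range fun a => diagStar d m (powPoint S m a))) :=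
    ENNReal.toReal_pos ((isOpen_interior.measure_pos volume
      (interior_smul_nonempty S hm hfull)).trans_le (measure_mono interior_subset)).ne'
      hc.measure_lt_top.ne
  positivity

theorem isFiberSection_iff {S : Finset (Fin d → ℝ)} (hm : 1 ≤ m)
    {γ : (Fin d → ℝ) → Fin m → Fin d → ℝ} :
    IsFiberSection (powPoint S m) (diagStar d m) volume γ ↔
      IntegrableOn γ ((m : ℝ) • convexHull ℝ (S : Set (Fin d → ℝ))) ∧
        ∀ x ∈ (m : ℝ) • convexHull ℝ (S : Set (Fin d → ℝ)),
          γ x ∈ polyPow (convexHull ℝ (S : Set (Fin d → ℝ))) m ∧ diagStar d m (γ x) = x := by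
  rw [smul_eq_convexHull S hm, polyPow_eq_convexHull]
  exact ⟨fun h => ⟨h.1, fun x hx => ⟨h.2 x hx, h.3 x hx⟩⟩,
    fun h => ⟨h.1, fun x hx => (h.2 x hx).1, fun x hx => (h.2 x hx).2⟩⟩

theorem fiberPolytope_eq {S : Finset (Fin d → ℝ)} (hm : 1 ≤ m) :
    fiberPolytope (convexHull ℝ (S : Set (Fin d → ℝ))) m =
      (fun w => (chowScale (convexHull ℝ (S : Set (Fin d → ℝ))) m)⁻¹ • w) ''
        sectionIntegrals (powPoint S m) (diagStar d m) := by
  have hfac : ((d + 1).factorial : ℝ) ≠ 0 := by positivity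
  have key : ∀ γ : (Fin d → ℝ) → Fin m → Fin d → ℝ,
      ⨍ x in (m : ℝ) • convexHull ℝ (S : Set (Fin d → ℝ)), γ x =
        (chowScale (convexHull ℝ (S : Set (Fin d → ℝ))) m)⁻¹ • (((d + 1).factorial : ℝ) •
          ∫ x in convexHull ℝ (Set.range fun a => diagStar d m (powPoint S m a)), γ x) := by
    intro γ
    rw [setAverage_eq, chowScale, smul_smul, smul_eq_convexHull S hm]
    congr 1
    field_simp
  ext w
  constructor
  · rintro ⟨γ, hγ, hmem, rfl⟩
    exact ⟨_, ⟨γ, (isFiberSection_iff hm).2 ⟨hγ, hmem⟩, rfl⟩, (key γ).symm⟩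
  · rintro ⟨_, ⟨γ, hγ, rfl⟩, rfl⟩
    obtain ⟨h1, h2⟩ := (isFiberSection_iff hm).1 hγ
    exact ⟨γ, h1, h2, (key γ).symm⟩

/-- The normal vectors of the section integrals compare like the fiberwise minimizers. -/
theorem forall_normalCone_sectionIntegrals_iff {S : Finset (Fin d → ℝ)} (hm : 1 ≤ m)
    (hfull : affineSpan ℝ (convexHull ℝ (S : Set (Fin d → ℝ))) = ⊤) (w w' : Fin m → Fin d → ℝ) :
    (∀ u ∈ sectionIntegrals (powPoint S m) (diagStar d m),
      w ∈ normalCone (pairingPow d m) (sectionIntegrals (powPoint S m) (diagStar d m)) u →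
      w' ∈ normalCone (pairingPow d m) (sectionIntegrals (powPoint S m) (diagStar d m)) u) ↔
      fiberMin (powPoint S m) (diagStar d m) (pairFun w) ⊆
        fiberMin (powPoint S m) (diagStar d m) (pairFun w') := by
  have hfac : (0 : ℝ) < (d + 1).factorial := by positivity
  have key : ∀ (γ : (Fin d → ℝ) → Fin m → Fin d → ℝ) (z : Fin m → Fin d → ℝ),
      z ∈ normalCone (pairingPow d m) (sectionIntegrals (powPoint S m) (diagStar d m))
        (((d + 1).factorial : ℝ) •
          ∫ x in convexHull ℝ (Set.range fun a => diagStar d m (powPoint S m a)), γ x) ↔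
      ∀ γ', IsFiberSection (powPoint S m) (diagStar d m) volume γ' →
        pairFun z (∫ x in convexHull ℝ (Set.range fun a => diagStar d m (powPoint S m a)), γ x) ≤
        pairFun z
          (∫ x in convexHull ℝ (Set.range fun a => diagStar d m (powPoint S m a)), γ' x) := by
    intro γ z
    constructor
    · intro h γ' hγ'
      have := h _ ⟨γ', hγ', rfl⟩
      simp only [map_smul, LinearMap.smul_apply, smul_eq_mul] at this
      exact le_of_mul_le_mul_left this hfac
    · rintro h _ ⟨γ', hγ', rfl⟩
      simp only [map_smul, LinearMap.smul_apply, smul_eq_mul]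
      exact mul_le_mul_of_nonneg_left (h γ' hγ') hfac.le
  rw [fiberMin_subset_iff volume (interior_smul_nonempty S hm hfull)]
  constructor
  · intro h γ hγ hmin
    exact (key γ w').1 (h _ ⟨γ, hγ, rfl⟩ ((key γ w).2 hmin))
  · rintro h _ ⟨γ, hγ, rfl⟩ hw
    exact (key γ w').2 (h γ hγ ((key γ w).1 hw))

/-- By `fiberPolytope_eq`, q*(Q) is a homothetic copy of the section integrals with positive ratio c
divided by the Chow scale, and homotheties preserve normal cones. This is how every scale is treated
at once. -/
theorem forall_normalCone_quotStar_iff {S : Finset (Fin d → ℝ)} (hm : 1 ≤ m)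
    (hfull : affineSpan ℝ (convexHull ℝ (S : Set (Fin d → ℝ))) = ⊤) {c : ℝ} (hc : 0 < c)
    {Q : Set (Module.Dual ℝ (DiagQuot d m))}
    (hQ : IsFiberPolytope (convexHull ℝ (S : Set (Fin d → ℝ))) m c Q)
    (w w' : Fin m → Fin d → ℝ) :
    (∀ u ∈ quotStar d m '' Q, w ∈ normalCone (pairingPow d m) (quotStar d m '' Q) u →
      w' ∈ normalCone (pairingPow d m) (quotStar d m '' Q) u) ↔
      fiberMin (powPoint S m) (diagStar d m) (pairFun w) ⊆
        fiberMin (powPoint S m) (diagStar d m) (pairFun w') := by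
  obtain ⟨-, t, ht⟩ := hQ
  set κ := chowScale (convexHull ℝ (S : Set (Fin d → ℝ))) m
  have hκ : 0 < c * κ⁻¹ := mul_pos hc (inv_pos.2 (chowScale_pos hm hfull))
  have heq : quotStar d m '' Q = (fun x => t + (c * κ⁻¹) • x) ''
      sectionIntegrals (powPoint S m) (diagStar d m) := by
    rw [ht, fiberPolytope_eq hm, Set.image_image]
    simp only [smul_smul, κ]
  rw [heq, ← forall_normalCone_sectionIntegrals_iff hm hfull, Set.forall_mem_image]
  refine forall₂_congr fun u _ => ?_
  rw [normalCone_homothety _ _ _ hκ]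

theorem quot_mem_normalCone_iff {Q : Set (Module.Dual ℝ (DiagQuot d m))}
    (y : Module.Dual ℝ (DiagQuot d m)) (w : Fin m → Fin d → ℝ) :
    quot d m w ∈ normalCone LinearMap.id Q y ↔
      w ∈ normalCone (pairingPow d m) (quotStar d m '' Q) (quotStar d m y) := by
  simp only [normalCone, Set.mem_ofPred_eq, Set.forall_mem_image, pairingPow_quotStar]
  rfl

/-- The fiber polytope is a lattice polytope, after scaling and translation. -/
theorem exists_isFiberPolytope {S : Finset (Fin d → ℝ)} (hm : 1 ≤ m)
    (hS : (S : Set (Fin d → ℝ)) ⊆ intLattice d)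
    (hfull : affineSpan ℝ (convexHull ℝ (S : Set (Fin d → ℝ))) = ⊤) :
    ∃ Q, IsFiberPolytope (convexHull ℝ (S : Set (Fin d → ℝ))) m
      (chowScale (convexHull ℝ (S : Set (Fin d → ℝ))) m) Q := by
  classical
  have hpt : ∀ a, powPoint S m a ∈ intLatticePow d m := fun a =>
    mem_intLatticePow_iff.2 fun i => hS (a i).2
  obtain ⟨V, ⟨b₀, hb₀⟩, hVL, hV⟩ := isLatticePolytope_sectionIntegrals
    (interior_smul_nonempty S hm hfull) hpt fun a => diagStar_mem_intLattice (hpt a)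
  -- Under δ* every section integral becomes (d+1)! times the integral of the identity over mP. So
  -- differences of vertices come from the quotient dual, and translating by the lattice point `-b₀`
  -- preserves integrality.
  have hconst : ∀ b ∈ V, diagStar d m (-b₀ + b) = 0 := by
    have hval : ∀ b ∈ V, diagStar d m b = ((d + 1).factorial : ℝ) •
        ∫ x in convexHull ℝ (Set.range fun a => diagStar d m (powPoint S m a)), x := by
      intro b hb
      have hb' : b ∈ sectionIntegrals (powPoint S m) (diagStar d m) := by
        rw [hV]
        exact subset_convexHull ℝ _ hb
      obtain ⟨γ, hγ, rfl⟩ := hb'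
      rw [map_smul]
      congr 1
      have h1 := (LinearMap.toContinuousLinearMap (diagStar d m)).integral_comp_comm hγ.1
      change _ = diagStar d m _ at h1
      rw [← h1]
      exact setIntegral_congr_fun (isCompact_convexHull_range _).measurableSet
        fun x hx => hγ.map x hx
    intro b hb
    rw [map_add, map_neg, hval b hb, hval b₀ hb₀, neg_add_cancel]
  choose! y hy using fun b hb => exists_quotStar_eq (hconst b hb)
  refine ⟨convexHull ℝ ((V.image y : Finset _) : Set (Module.Dual ℝ (DiagQuot d m))),
    ⟨V.image y, ⟨y b₀, Finset.mem_image_of_mem y hb₀⟩, ?_, rfl⟩, -b₀, ?_⟩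
  · rw [Finset.coe_image]
    rintro _ ⟨b, hb, rfl⟩
    change quotStar d m (y b) ∈ intLatticePow d m
    rw [hy b hb]
    exact (intLatticePow d m).add_mem ((intLatticePow d m).neg_mem (hVL hb₀)) (hVL hb)
  · have hκ := (chowScale_pos hm hfull).ne'
    rw [LinearMap.image_convexHull, Finset.coe_image, Set.image_image, fiberPolytope_eq hm,
      Set.image_image]
    simp only [smul_smul, mul_inv_cancel₀ hκ, one_smul]
    rw [hV, Set.image_congr (g := fun b => -b₀ + b) (fun b hb => hy b hb)]
    change _ = (fun x => -b₀ + x) '' _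
    rw [← Set.singleton_add, ← Set.singleton_add, convexHull_add, convexHull_singleton]

end Coordinates

/-! ### The polytope R(P,m), its fibers and its Cayley structure -/

section Main

variable {d m : ℕ}

/-- Since q* is adjoint to q, pairing (p, y) with ι(v) is pairing p + q*(y) with v. The pulled back
support function is therefore that of the Minkowski sum, which a polytope recovers. -/
theorem familyPolytope_eq {P : Set (Fin d → ℝ)} {Q : Set (Module.Dual ℝ (DiagQuot d m))}
    {L : AddSubgroup (Fin m → Fin d → ℝ)}
    (h : IsLatticePolytope L (polyPow P m + quotStar d m '' Q)) :
    familyPolytope P m Q = polyPow P m + quotStar d m '' Q := by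
  rw [← polytopeOfSupportFunction_supportFunction (pairingPow d m) exists_pairingPow_eq h]
  unfold familyPolytope
  rw [polytopeOfSupportFunction_supportFunction (pairingPow d m) exists_pairingPow_eq h]
  conv_rhs => rw [← polytopeOfSupportFunction_supportFunction (pairingPow d m)
    exists_pairingPow_eq h]
  congr 1
  ext v
  unfold supportFunction
  congr 1
  have key : ∀ p y, pairingProd d m (p, y) (graphEmb d m v) =
      pairingPow d m (p + quotStar d m y) v := by
    intro p y
    rw [map_add, LinearMap.add_apply, pairingPow_quotStar]
    rfl
  ext r
  constructor
  · rintro ⟨⟨p, y⟩, ⟨hp, hy⟩, rfl⟩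
    exact ⟨_, Set.add_mem_add hp ⟨y, hy, rfl⟩, (key p y).symm⟩
  · rintro ⟨_, ⟨p, hp, _, ⟨y, hy, rfl⟩, rfl⟩, rfl⟩
    exact ⟨(p, y), ⟨hp, hy⟩, key p y⟩

theorem fiberOver_add_quotStar (K : Set (Fin m → Fin d → ℝ))
    (Q : Set (Module.Dual ℝ (DiagQuot d m))) (v : Fin d → ℝ) :
    fiberOver (K + quotStar d m '' Q) v = fiberOver K v + quotStar d m '' Q := by
  ext u
  constructor
  · rintro ⟨⟨p, hp, _, ⟨y, hy, rfl⟩, rfl⟩, hv⟩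
    refine ⟨p, ⟨hp, ?_⟩, _, ⟨y, hy, rfl⟩, rfl⟩
    simpa [diagStar_quotStar] using hv
  · rintro ⟨p, ⟨hp, hv⟩, _, ⟨y, hy, rfl⟩, rfl⟩
    exact ⟨⟨p, hp, _, ⟨y, hy, rfl⟩, rfl⟩, by simp [diagStar_quotStar, hv]⟩

theorem diagStar_image_add_quotStar (K : Set (Fin m → Fin d → ℝ))
    {Q : Set (Module.Dual ℝ (DiagQuot d m))} (hQ : Q.Nonempty) :
    diagStar d m '' (K + quotStar d m '' Q) = diagStar d m '' K := by
  ext x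
  constructor
  · rintro ⟨_, ⟨p, hp, _, ⟨y, hy, rfl⟩, rfl⟩, rfl⟩
    exact ⟨p, hp, by simp [diagStar_quotStar]⟩
  · rintro ⟨p, hp, rfl⟩
    obtain ⟨y, hy⟩ := hQ
    exact ⟨_, ⟨p, hp, _, ⟨y, hy, rfl⟩, rfl⟩, by simp [diagStar_quotStar]⟩

/-- Minimizing over the fiber through `u` is the definition of `fiberMin`, so a single fiber tests
the global preorder at its own points only. -/
theorem mem_fiberOver_normalCone_iff {S : Finset (Fin d → ℝ)} {v : Fin d → ℝ}
    {u : Fin m → Fin d → ℝ}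
    (hu : u ∈ fiberOver (polyPow (convexHull ℝ (S : Set (Fin d → ℝ))) m) v)
    (w : Fin m → Fin d → ℝ) :
    w ∈ normalCone (pairingPow d m)
        (fiberOver (polyPow (convexHull ℝ (S : Set (Fin d → ℝ))) m) v) u ↔
      u ∈ fiberMin (powPoint S m) (diagStar d m) (pairFun w) := by
  obtain ⟨huK, rfl⟩ := hu
  unfold fiberMin
  rw [← polyPow_eq_convexHull]
  exact ⟨fun h => ⟨huK, fun u' hu' hv => h u' ⟨hu', hv⟩⟩, fun h u' hu' => h.2 u' hu'.1 hu'.2⟩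

variable {S : Finset (Fin d → ℝ)} {c : ℝ} {Q : Set (Module.Dual ℝ (DiagQuot d m))}

theorem normalFan_eq_quotientFan (hm : 1 ≤ m)
    (hfull : affineSpan ℝ (convexHull ℝ (S : Set (Fin d → ℝ))) = ⊤) (hc : 0 < c)
    (hQ : IsFiberPolytope (convexHull ℝ (S : Set (Fin d → ℝ))) m c Q) :
    normalFan LinearMap.id Q = quotientFan (convexHull ℝ (S : Set (Fin d → ℝ))) m := by
  have hcomm : commonRefinement (normalFan LinearMap.id Q) = normalFan LinearMap.id Q := by
    obtain ⟨⟨T, hT, -, rfl⟩, -⟩ := hQ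
    exact commonRefinement_normalFan _ hT
  rw [← hcomm]
  unfold quotientFan commonRefinement
  congr 1
  ext x x'
  obtain ⟨w, rfl⟩ := quot_surjective x
  obtain ⟨w', rfl⟩ := quot_surjective x'
  rw [mem_sInter_quotientFan_iff hm hfull, ← forall_normalCone_quotStar_iff hm hfull hc hQ,
    mem_sInter_normalFan, Set.forall_mem_image]
  refine forall₂_congr fun y _ => ?_
  rw [quot_mem_normalCone_iff, quot_mem_normalCone_iff]

theorem normalFan_add_quotStar_eq_familyFan {P : Set (Fin d → ℝ)}
    (hfan : normalFan LinearMap.id Q = quotientFan P m) :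
    normalFan (pairingPow d m) (polyPow P m + quotStar d m '' Q) = familyFan P m := by
  have key : ∀ p ∈ polyPow P m, ∀ y ∈ Q,
      normalCone (pairingPow d m) (polyPow P m + quotStar d m '' Q) (p + quotStar d m y) =
        quot d m ⁻¹' normalCone LinearMap.id Q y ∩
          normalCone (pairingPow d m) (polyPow P m) p := by
    intro p hp y hy
    rw [normalCone_add _ hp (Set.mem_image_of_mem _ hy), Set.inter_comm]
    congr 1
    ext w
    exact (quot_mem_normalCone_iff y w).symm
  unfold familyFan
  rw [← hfan, fanPow_eq]
  ext ρ
  constructor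
  · rintro ⟨_, ⟨p, hp, _, ⟨y, hy, rfl⟩, rfl⟩, rfl⟩
    exact ⟨_, ⟨y, hy, rfl⟩, _, ⟨p, hp, rfl⟩, key p hp y hy⟩
  · rintro ⟨_, ⟨y, hy, rfl⟩, _, ⟨p, hp, rfl⟩, rfl⟩
    exact ⟨_, Set.add_mem_add hp ⟨y, hy, rfl⟩, key p hp y hy⟩

theorem quotStar_mem_intLatticePow :
    ∀ y ∈ quotDualLattice d m, quotStar d m y ∈ intLatticePow d m := fun _ hy => hy

theorem normallyEquivalent_fiber (hm : 1 ≤ m)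
    (hfull : affineSpan ℝ (convexHull ℝ (S : Set (Fin d → ℝ))) = ⊤) (hc : 0 < c)
    (hQ : IsFiberPolytope (convexHull ℝ (S : Set (Fin d → ℝ))) m c Q) {v : Fin d → ℝ}
    (hv : v ∈ (m : ℝ) • convexHull ℝ (S : Set (Fin d → ℝ))) :
    NormallyEquivalent (pairingPow d m)
      (fiberOver (polyPow (convexHull ℝ (S : Set (Fin d → ℝ))) m) v + quotStar d m '' Q)
      (quotStar d m '' Q) := by
  set K := fiberOver (polyPow (convexHull ℝ (S : Set (Fin d → ℝ))) m) v with hK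
  have hQ' := hQ.1.image (quotStar d m) quotStar_mem_intLatticePow
  -- For real `v` the fiber need not have lattice vertices; the lattice `⊤` records only that it is
  -- a polytope.
  have hKpoly : IsLatticePolytope ⊤ K := by
    have h := isLatticePolytope_top_fiber (powPoint S m) (diagStar d m) (v := v)
    rw [← polyPow_eq_convexHull] at h
    refine h ?_
    rw [← diagStar_image_polyPow (convex_convexHull ℝ _) hm] at hv
    obtain ⟨u, hu, rfl⟩ := hv
    exact ⟨u, hu, rfl⟩
  have hsum := hKpoly.add (hQ'.mono le_top)
  refine normallyEquivalent_of_normalFan_eq' _ exists_pairingPow_eq hsum hQ' ?_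
  refine normalFan_eq_of_forall _ hsum hQ' fun w w' => ?_
  constructor
  · intro h y hy hw
    -- Pairing `y` with a point of the fiber minimal for `w` puts `w` in the normal cone of the sum,
    -- from which the second factor is read off.
    have hne : (minFace (pairingPow d m) K w).Nonempty := by
      obtain ⟨T, hT, -, hKT⟩ := hKpoly
      rw [hKT]
      exact minFace_nonempty _ hT w
    obtain ⟨p, hp, hpw⟩ := hne
    have := h (p + y) (Set.add_mem_add hp hy)
    rw [normalCone_add _ hp hy] at this
    exact (this ⟨hpw, hw⟩).2
  · rintro h _ ⟨p, hp, y, hy, rfl⟩ hw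
    simp only at hw ⊢
    rw [normalCone_add _ hp hy] at hw ⊢
    refine ⟨?_, h y hy hw.2⟩
    rw [mem_fiberOver_normalCone_iff hp]
    -- The inclusion for q*(Q) is the global inclusion of fiberwise minimizers, which applies in
    -- particular on this fiber.
    exact (forall_normalCone_quotStar_iff hm hfull hc hQ w w').1 h
      ((mem_fiberOver_normalCone_iff hp w).1 hw.1)

theorem exists_isGeneralizedTwistedCayleySum (hm : 1 ≤ m)
    (hS : (S : Set (Fin d → ℝ)) ⊆ intLattice d) (hQ : IsLatticePolytope (quotDualLattice d m) Q) :
    ∃ (k : ℕ) (Rs : Fin k → Set (Fin m → Fin d → ℝ)),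
      IsGeneralizedTwistedCayleySum (pairingPow d m) (intLatticePow d m) (intLattice d)
        (diagStar d m) Rs
        (polyPow (convexHull ℝ (S : Set (Fin d → ℝ))) m + quotStar d m '' Q)
        ((m : ℝ) • convexHull ℝ (S : Set (Fin d → ℝ))) ∧
      ∀ i, NormallyEquivalent (pairingPow d m) (Rs i) (quotStar d m '' Q) := by
  classical
  have hQ' := hQ.image (quotStar d m) quotStar_mem_intLatticePow
  have hpt : ∀ a, powPoint S m a ∈ intLatticePow d m := fun a =>
    mem_intLatticePow_iff.2 fun i => hS (a i).2
  let e := (Fintype.equivFin (Fin m → S)).symm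
  -- One summand per tuple of generators: the hull of these translates is the hull of the tuples
  -- plus q*(Q), and δ* collapses each translate to the sum of its tuple.
  let Rs : Fin (Fintype.card (Fin m → S)) → Set (Fin m → Fin d → ℝ) := fun i =>
    (fun x => powPoint S m (e i) + x) '' (quotStar d m '' Q)
  have hRs : ∀ i, IsLatticePolytope (intLatticePow d m) (Rs i) := fun i => hQ'.translate (hpt _)
  refine ⟨_, Rs, ⟨map_diagStar_intLatticePow hm, hRs, fun i j => ?_, ?_, fun i =>
    diagStar d m (powPoint S m (e i)), fun i => diagStar_mem_intLattice (hpt _), fun i => ?_, ?_⟩,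
    fun i => ?_⟩
  · exact normallyEquivalent_of_normalFan_eq' _ exists_pairingPow_eq (hRs i) (hRs j)
      ((normalFan_translate _ _ _).trans (normalFan_translate _ _ _).symm)
  · have hU : ⋃ i, Rs i = Set.range (powPoint S m) + quotStar d m '' Q := by
      ext x
      simp only [Set.mem_iUnion]
      constructor
      · rintro ⟨i, y, hy, rfl⟩
        exact Set.add_mem_add ⟨_, rfl⟩ hy
      · rintro ⟨_, ⟨a, rfl⟩, y, hy, rfl⟩
        exact ⟨e.symm a, y, hy, by simp⟩
    rw [hU, convexHull_add, hQ'.convex.convexHull_eq, polyPow_eq_convexHull]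
  · ext x
    constructor
    · rintro ⟨_, ⟨_, ⟨y, hy, rfl⟩, rfl⟩, rfl⟩
      simp [diagStar_quotStar]
    · rintro rfl
      obtain ⟨y, hy⟩ := hQ.nonempty
      exact ⟨_, ⟨_, ⟨y, hy, rfl⟩, rfl⟩, by simp [diagStar_quotStar]⟩
  · rw [smul_eq_convexHull S hm]
    congr 1
    exact (e.surjective.range_comp fun a => diagStar d m (powPoint S m a)).symm
  · exact normallyEquivalent_of_normalFan_eq' _ exists_pairingPow_eq (hRs i) hQ'
      (normalFan_translate _ _ _)

end Main

end TwistedCayley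

theorem mainTheorem3 (d m : ℕ) (hm : 1 ≤ m) (P : Set (Fin d → ℝ))
    (hP : IsLatticePolytope (intLattice d) P) (hfull : affineSpan ℝ P = ⊤) :
    (∃ Q, IsFiberPolytope P m (chowScale P m) Q) ∧
    ∀ (c : ℝ) (_ : 0 < c) (Q : Set (Module.Dual ℝ (DiagQuot d m))),
      IsFiberPolytope P m c Q →
      normalFan LinearMap.id Q = quotientFan P m ∧
      IsLatticePolytope (intLatticePow d m) (familyPolytope P m Q) ∧
      normalFan (pairingPow d m) (familyPolytope P m Q) = familyFan P m ∧
      familyPolytope P m Q = polyPow P m + quotStar d m '' Q ∧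
      diagStar d m '' familyPolytope P m Q = (m : ℝ) • P ∧
      (∃ (k : ℕ) (Rs : Fin k → Set (Fin m → Fin d → ℝ)),
        IsGeneralizedTwistedCayleySum (pairingPow d m) (intLatticePow d m) (intLattice d)
          (diagStar d m) Rs (familyPolytope P m Q) ((m : ℝ) • P) ∧
        ∀ i, NormallyEquivalent (pairingPow d m) (Rs i) (quotStar d m '' Q)) ∧
      ∀ v ∈ (m : ℝ) • P,
        fiberOver (familyPolytope P m Q) v
          = fiberOver (polyPow P m) v + quotStar d m '' Q ∧
        NormallyEquivalent (pairingPow d m) (fiberOver (familyPolytope P m Q) v)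
          (quotStar d m '' Q) := by
  obtain ⟨S, hS, hSL, rfl⟩ := hP
  refine ⟨exists_isFiberPolytope hm hSL hfull, fun c hc Q hQ => ?_⟩
  have hpt : ∀ a, powPoint S m a ∈ intLatticePow d m := fun a =>
    mem_intLatticePow_iff.2 fun i => hSL (a i).2
  have hpow : IsLatticePolytope (intLatticePow d m) (polyPow (convexHull ℝ (S : Set _)) m) := by
    classical
    have : Nonempty S := hS.coe_sort
    refine ⟨Finset.univ.image (powPoint S m), Finset.univ_nonempty.image _, ?_, ?_⟩
    · simpa [Set.range_subset_iff] using hpt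
    · rw [polyPow_eq_convexHull, Finset.coe_image, Finset.coe_univ, Set.image_univ]
  have hQ' := hQ.1.image (quotStar d m) quotStar_mem_intLatticePow
  have hfan := normalFan_eq_quotientFan hm hfull hc hQ
  rw [familyPolytope_eq (hpow.add hQ')]
  refine ⟨hfan, hpow.add hQ', normalFan_add_quotStar_eq_familyFan hfan, rfl, ?_,
    exists_isGeneralizedTwistedCayleySum hm hSL hQ.1, fun v hv => ?_⟩
  · rw [diagStar_image_add_quotStar _ hQ.1.nonempty,
      diagStar_image_polyPow (convex_convexHull ℝ _) hm]
  · rw [fiberOver_add_quotStar]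
    exact ⟨rfl, normallyEquivalent_fiber hm hfull hc hQ hv⟩
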